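/- For $n\ge 1$ let $\mathcal H_n$ be the space of real symmetric $n\times n$ matrices, with $\langle A,B\rangle=\mathrm{Tr}(AB)$. For $k\ge 1$ and $\varepsilon>0$ let $\mathcal D_\varepsilon=\{w\in\mathbb R^n:\|w\|_2\le 1,\ \|w\|_\infty\le\varepsilon\}$ and $$\mathcal F_\varepsilon^k=\Big\{\sum_{\ell=1}^k\theta_\ell v_\ell v_\ell^{\mathsf T}:\ v_\ell\in\mathcal D_\varepsilon,\ |\theta_\ell|\le 1\ \text{ for } 1\le \ell\le k\Big\}.$$ For every $k\ge 1$ there exist constants $\gamma_0,p_0>0$, depending only on $k$, such that the following holds. Let $n\ge 2$, $p\in[0,1]$, $\varepsilon\in(0,1/3)$ and $t$ satisfy $np\ge 4\log n$, $p\le p_0$, $$\frac{\gamma_0}{\sqrt{\log(1/p)}}\le t\le\frac1{\gamma_0}\qquad\text{and}\qquad \frac{\log\big(t^2\log(1/p)\big)}{t\sqrt{\log(1/p)}}\le\varepsilon .$$ Let $G$ and $\Xi$ be independent random matrices in $\mathcal H_n$ such that the entries $(G_{i,j})_{i\le j}$ are independent, centered and bounded by $1$ in absolute value (not necessarily identically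 distributed), and the entries $(\Xi_{i,j})_{i\le j}$ are i.i.d. Bernoulli with parameter $p$. Let $X=(np)^{-1/2}\,G\circ\Xi$, where $\circ$ is the entrywise product. Let $f:\mathcal H_n\to\mathbb R$ be a convex function for which there is a measurable map $\zeta:\mathcal H_n\to\mathcal F_\varepsilon^k$ with $$f(K)-f(K')\le\langle\zeta(K),K-K'\rangle\qquad\text{for all }K,K'\in\mathcal H_n .$$ Then $f(X)$ is integrable and $$\mathbb P\big(f(X)-\mathbb E f(X)>t\big)\le 2\exp\Big(-\frac{t^2np}{\gamma_0\varepsilon^2}\Big).$$ -/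

import Mathlib

open MeasureTheory ProbabilityTheory
open scoped Matrix unitInterval

namespace SparseWigner

/-- The real vector space of symmetric `n × n` real matrices. -/
def SymMat (n : ℕ) : Submodule ℝ (Matrix (Fin n) (Fin n) ℝ) where
  carrier := {K | K.IsSymm}
  add_mem' := fun ha hb => ha.add hb
  zero_mem' := Matrix.isSymm_zero
  smul_mem' := fun c _ ha => ha.smul c

/-- The σ-algebra on symmetric matrices generated by the entries; it is the Borel σ-algebra of the
finite-dimensional space `SymMat n`. -/
instance instMeasurableSpaceSymMat (n : ℕ) : MeasurableSpace (SymMat n) :=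
  MeasurableSpace.comap (fun K : SymMat n => fun i j => K.1 i j)
    (inferInstance : MeasurableSpace (Fin n → Fin n → ℝ))

/-- The inner product `⟨A, B⟩ = Tr (A B)` on symmetric matrices. -/
def traceInner {n : ℕ} (A B : SymMat n) : ℝ :=
  Matrix.trace (A.1 * B.1)

/-- Delocalised vectors: `w` in the unit Euclidean ball with `‖w‖_∞ ≤ ε`. -/
def delocalized (n : ℕ) (ε : ℝ) : Set (EuclideanSpace ℝ (Fin n)) :=
  {w | ‖w‖ ≤ 1 ∧ ∀ i, |w i| ≤ ε}

/-- Flat matrices: `∑_{ℓ ≤ k} θ_ℓ v_ℓ v_ℓᵀ` with `|θ_ℓ| ≤ 1` and delocalised `v_ℓ`. -/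
def flat (n k : ℕ) (ε : ℝ) : Set (SymMat n) :=
  {A | ∃ (θ : Fin k → ℝ) (v : Fin k → EuclideanSpace ℝ (Fin n)),
    (∀ l, |θ l| ≤ 1) ∧ (∀ l, v l ∈ delocalized n ε) ∧
    A.1 = ∑ l, θ l • Matrix.vecMulVec (v l) (v l)}

/-- The matrix `(G ∘ Ξ) / √(n p)`, where `∘` is the entrywise product. -/
noncomputable def sparse {n : ℕ} (p : ℝ) (G Ξ : SymMat n) : SymMat n :=
  ⟨(Real.sqrt (n * p))⁻¹ • (G.1 ⊙ Ξ.1), by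
    apply Submodule.smul_mem
    ext i j
    simp only [Matrix.transpose_apply, Matrix.hadamard_apply]
    rw [G.2.apply i j, Ξ.2.apply i j]⟩

/-- Index set of the entries on and above the diagonal. -/
abbrev UpperIndex (n : ℕ) : Type := {e : Fin n × Fin n // e.1 ≤ e.2}

/-- `G` and `Ξ` are independent random symmetric matrices; the entries of `G` on and above the
diagonal are independent, centered and bounded by `1` (not necessarily identically distributed),
and those of `Ξ` are i.i.d. Bernoulli variables with parameter `p`. -/
structure IsBoundedSparseModel {Ω : Type*} [MeasurableSpace Ω] (P : Measure Ω) {n : ℕ} (p : I)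
    (G Ξ : Ω → SymMat n) : Prop where
  measurable_G : Measurable G
  measurable_Ξ : Measurable Ξ
  indep : IndepFun G Ξ P
  indep_G : iIndepFun (fun (e : UpperIndex n) ω => (G ω).1 e.1.1 e.1.2) P
  centered_G : ∀ i j, ∫ ω, (G ω).1 i j ∂P = 0
  bounded_G : ∀ i j, ∀ᵐ ω ∂P, |(G ω).1 i j| ≤ 1
  indep_Ξ : iIndepFun (fun (e : UpperIndex n) ω => (Ξ ω).1 e.1.1 e.1.2) P
  bernoulli_Ξ : ∀ i j, HasLaw (fun ω => (Ξ ω).1 i j) (bernoulliMeasure (1 : ℝ) 0 p) P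

end SparseWigner

/-! A function with flat subgradients is the supremum of its supporting affine functions, whose
slopes are sums of `k` terms `θ v vᵀ` with `|v i| ≤ ε`. Write `p = exp (-L)`, `s = (np)^(-1/2)` and
let `ξ` be the Bernoulli array. Changing one entry of the matrix moves such a supremum by at most
the matching coefficient of a near-optimal slope, so the Efron–Stein variance proxy is `s²` times a
supremum of `∑ v_i² v_j² (ξ_ij + p)`. This proxy is random, and the target rate requires it to
behave like `s² ε²` in exponential moments.

To this end each slope is cut at products `|v_i v_j| ≤ ε η`. The supremum with light slopes is
treated by the entropy method: tensorization, a one-sided Dirichlet form, the Herbst argument, and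
the Gibbs inequality to decouple the random proxy (`log_integral_exp_le_of_sum_sq_le`). The
remainder is at most `k s` times a supremum of `∑ v_i v_j ξ_ij` over heavy products, which is
bounded directly without centring. A small `η` widens the range of exponential moments available for
the light part; a large `η` makes the heavy part, of size `ε / η`, small. The choice `η ≍ k ε / (t
√(np))` makes the heavy part a small fraction of `t`.

Both suprema are controlled by a union bound in exponential form. Vectors are discretised, either to
pairs of sets (`blockForm_le`) or to dyadic vectors (`levelForm_le`), and a quadratic form is
bounded by the logarithm of a weighted exponential sum over all discretised objects, plus the
logarithm of one weight. Expectations of these sums factor over independent entries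
(`integral_blockSum_le`, `integral_levelSum_le`), and convexity of `exp` handles combinations of
their logarithms (`integral_exp_sum_log_le`). Products are light when one factor is at most `η`
(blocks) or both are at least `η` (levels); a heavy product forces both factors above `η`, so dyadic
levels suffice there. `measureReal_truncSup_le` combines the two parts by Chernoff bounds. -/

namespace SparseWigner

/-! ### The entropy method for bounded functions of independent variables -/

/-- Bounded measurable real functions. -/
structure BddMeas {α : Type*} [MeasurableSpace α] (g : α → ℝ) : Prop where
  meas : Measurable g
  bdd : ∃ C, ∀ x, |g x| ≤ C

namespace BddMeas

variable {α β : Type*} [MeasurableSpace α] [MeasurableSpace β] {g h : α → ℝ}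

lemma integrable (hg : BddMeas g) (μ : Measure α) [IsFiniteMeasure μ] : Integrable g μ := by
  obtain ⟨C, hC⟩ := hg.bdd
  exact Integrable.of_bound hg.meas.aestronglyMeasurable C (.of_forall hC)

lemma const (c : ℝ) : BddMeas (fun _ : α => c) := ⟨measurable_const, |c|, fun _ => le_rfl⟩

lemma add (hg : BddMeas g) (hh : BddMeas h) : BddMeas (fun x => g x + h x) := by
  obtain ⟨C, hC⟩ := hg.bdd
  obtain ⟨D, hD⟩ := hh.bdd
  exact ⟨hg.meas.add hh.meas, C + D, fun x => (abs_add_le _ _).trans (add_le_add (hC x) (hD x))⟩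

lemma neg (hg : BddMeas g) : BddMeas (fun x => -g x) := by
  obtain ⟨C, hC⟩ := hg.bdd
  exact ⟨hg.meas.neg, C, fun x => by simpa using hC x⟩

lemma sub (hg : BddMeas g) (hh : BddMeas h) : BddMeas (fun x => g x - h x) := by
  simpa only [sub_eq_add_neg] using hg.add hh.neg

lemma mul (hg : BddMeas g) (hh : BddMeas h) : BddMeas (fun x => g x * h x) := by
  obtain ⟨C, hC⟩ := hg.bdd
  obtain ⟨D, hD⟩ := hh.bdd
  refine ⟨hg.meas.mul hh.meas, C * D, fun x => ?_⟩
  rw [abs_mul]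
  exact mul_le_mul (hC x) (hD x) (abs_nonneg _) ((abs_nonneg _).trans (hC x))

lemma const_mul (c : ℝ) (hg : BddMeas g) : BddMeas (fun x => c * g x) := (const c).mul hg

lemma pow (hg : BddMeas g) (k : ℕ) : BddMeas (fun x => g x ^ k) := by
  induction k with
  | zero => simpa using const 1
  | succ k ih => simpa only [pow_succ] using ih.mul hg

lemma exp (hg : BddMeas g) : BddMeas (fun x => Real.exp (g x)) := by
  obtain ⟨C, hC⟩ := hg.bdd
  refine ⟨Real.measurable_exp.comp hg.meas, Real.exp C, fun x => ?_⟩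
  rw [abs_of_pos (Real.exp_pos _)]
  exact Real.exp_le_exp.2 ((le_abs_self _).trans (hC x))

lemma posPart (hg : BddMeas g) : BddMeas (fun x => max (g x) 0) := by
  obtain ⟨C, hC⟩ := hg.bdd
  refine ⟨hg.meas.max measurable_const, C, fun x => ?_⟩
  rw [abs_of_nonneg (le_max_right _ _)]
  exact max_le ((le_abs_self _).trans (hC x)) ((abs_nonneg _).trans (hC x))

lemma comp (hg : BddMeas g) {φ : β → α} (hφ : Measurable φ) : BddMeas (fun y => g (φ y)) := by
  obtain ⟨C, hC⟩ := hg.bdd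
  exact ⟨hg.meas.comp hφ, C, fun y => hC _⟩

lemma sum {ι : Type*} (s : Finset ι) {G : ι → α → ℝ} (hG : ∀ i ∈ s, BddMeas (G i)) :
    BddMeas (fun x => ∑ i ∈ s, G i x) := by
  classical
  induction s using Finset.induction_on with
  | empty => simpa using const 0
  | insert a s ha ih =>
    simp only [Finset.sum_insert ha]
    exact (hG a (Finset.mem_insert_self _ _)).add
      (ih fun i hi => hG i (Finset.mem_insert_of_mem hi))

lemma integral_right {G : α × β → ℝ} (hG : BddMeas G) (ν : Measure β) [IsProbabilityMeasure ν] :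
    BddMeas (fun x => ∫ y, G (x, y) ∂ν) := by
  obtain ⟨C, hC⟩ := hG.bdd
  refine ⟨(hG.meas.stronglyMeasurable.integral_prod_right').measurable, C, fun x => ?_⟩
  have := norm_integral_le_of_norm_le_const (μ := ν) (f := fun y => G (x, y))
    (.of_forall fun y => hC (x, y))
  simpa using this

lemma log_of_pos (hg : BddMeas g) {a : ℝ} (ha : 0 < a) (hga : ∀ x, a ≤ g x) :
    BddMeas (fun x => Real.log (g x)) := by
  obtain ⟨C, hC⟩ := hg.bdd
  refine ⟨Real.measurable_log.comp hg.meas, |Real.log a| + |Real.log C|, fun x => ?_⟩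
  have hx : 0 < g x := ha.trans_le (hga x)
  have h1 := Real.log_le_log ha (hga x)
  have h2 := Real.log_le_log hx ((le_abs_self _).trans (hC x))
  rw [abs_le]
  constructor
  · linarith [neg_abs_le (Real.log a), abs_nonneg (Real.log C)]
  · linarith [le_abs_self (Real.log C), abs_nonneg (Real.log a)]

lemma log_integral_exp {G : α × β → ℝ} (hG : BddMeas G) (ν : Measure β)
    [IsProbabilityMeasure ν] : BddMeas (fun x => Real.log (∫ y, Real.exp (G (x, y)) ∂ν)) := by
  obtain ⟨C, hC⟩ := hG.bdd
  refine (hG.exp.integral_right ν).log_of_pos (Real.exp_pos (-C)) fun x => ?_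
  have := integral_mono (μ := ν) (integrable_const (Real.exp (-C)))
    ((hG.exp.comp (measurable_prodMk_left (x := x))).integrable ν)
    fun y => Real.exp_le_exp.2 (neg_le_of_abs_le (hC (x, y)))
  simpa using this

end BddMeas

lemma integral_exp_pos_of_bddMeas {α : Type*} [MeasurableSpace α] (μ : Measure α)
    [IsProbabilityMeasure μ] {g : α → ℝ} (hg : BddMeas g) : 0 < ∫ x, Real.exp (g x) ∂μ :=
  integral_exp_pos (hg.exp.integrable μ)

/-- The entropy of `exp g`. -/
noncomputable def expEnt {α : Type*} [MeasurableSpace α] (μ : Measure α) (g : α → ℝ) : ℝ :=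
  ∫ x, Real.exp (g x) * g x ∂μ - (∫ x, Real.exp (g x) ∂μ) * Real.log (∫ x, Real.exp (g x) ∂μ)

/-! ### Entropy: variational inequality, one-variable bound, subadditivity. -/

section Entropy

variable {α β : Type*} [MeasurableSpace α] [MeasurableSpace β]

/-- The Gibbs variational inequality. -/
lemma integral_exp_mul_le_expEnt_add (μ : Measure α) [IsProbabilityMeasure μ] {g h : α → ℝ}
    (hg : BddMeas g) (hh : BddMeas h) :
    ∫ x, Real.exp (g x) * h x ∂μ ≤
      expEnt μ g + (∫ x, Real.exp (g x) ∂μ) * Real.log (∫ x, Real.exp (h x) ∂μ) := by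
  set a := ∫ x, Real.exp (g x) ∂μ with ha
  set b := ∫ x, Real.exp (h x) ∂μ with hb
  have ha0 : 0 < a := integral_exp_pos_of_bddMeas μ hg
  have hb0 : 0 < b := integral_exp_pos_of_bddMeas μ hh
  have key : ∫ x, (Real.exp (g x) * h x - Real.exp (g x) * g x
      + (Real.log a - Real.log b) * Real.exp (g x)) ∂μ ≤
      ∫ x, (a / b * Real.exp (h x) - Real.exp (g x)) ∂μ := by
    refine integral_mono ((((hg.exp.mul hh).sub (hg.exp.mul hg)).add
      (hg.exp.const_mul _)).integrable μ)
      (((hh.exp.const_mul _).sub hg.exp).integrable μ) fun x => ?_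
    -- The inequality `1 + u ≤ exp u` at the logarithmic ratio of the normalised densities `exp h /
    -- b` and `exp g / a`: nonnegativity of relative entropy, pointwise.
    have h1 := Real.add_one_le_exp (h x - g x + (Real.log a - Real.log b))
    have h2 : Real.exp (g x) * Real.exp (h x - g x + (Real.log a - Real.log b)) =
        a / b * Real.exp (h x) := by
      rw [← Real.exp_add, show g x + (h x - g x + (Real.log a - Real.log b)) =
        h x + (Real.log a - Real.log b) by ring, Real.exp_add, Real.exp_sub, Real.exp_log ha0,
        Real.exp_log hb0, mul_comm]
    have h3 := mul_le_mul_of_nonneg_left h1 (Real.exp_pos (g x)).le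
    simp only
    linarith
  rw [integral_add (((hg.exp.mul hh).sub (hg.exp.mul hg)).integrable μ)
    ((hg.exp.const_mul _).integrable μ), integral_sub ((hg.exp.mul hh).integrable μ)
    ((hg.exp.mul hg).integrable μ), integral_sub ((hh.exp.const_mul _).integrable μ)
    (hg.exp.integrable μ), integral_const_mul, integral_const_mul, ← ha, ← hb,
    div_mul_cancel₀ _ hb0.ne'] at key
  unfold expEnt
  rw [← ha]
  linarith

/-- Jensen's inequality, as the Gibbs inequality for the untilted measure. -/
lemma integral_le_log_integral_exp (μ : Measure α) [IsProbabilityMeasure μ] {g : α → ℝ}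
    (hg : BddMeas g) : ∫ x, g x ∂μ ≤ Real.log (∫ x, Real.exp (g x) ∂μ) := by
  simpa [expEnt] using integral_exp_mul_le_expEnt_add μ (BddMeas.const (0 : ℝ)) hg

/-- The entropy of `exp g` in one variable is at most a one-sided Dirichlet form. -/
lemma expEnt_le_integral_sq (μ : Measure α) [IsProbabilityMeasure μ] {g : α → ℝ}
    (hg : BddMeas g) :
    expEnt μ g ≤ ∫ x, Real.exp (g x) * ∫ y, (max (g x - g y) 0) ^ 2 ∂μ ∂μ := by
  have hg1 : BddMeas (fun q : α × α => g q.1) := hg.comp measurable_fst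
  have hg2 : BddMeas (fun q : α × α => g q.2) := hg.comp measurable_snd
  have hjensen := integral_le_log_integral_exp μ hg
  have hpos := integral_exp_pos_of_bddMeas μ hg
  have hD : BddMeas (fun q : α × α => Real.exp (g q.1) * (max (g q.1 - g q.2) 0) ^ 2) :=
    hg1.exp.mul ((hg1.sub hg2).posPart.pow 2)
  have hE : BddMeas (fun q : α × α => Real.exp (g q.1) * (g q.1 - g q.2)) :=
    hg1.exp.mul (hg1.sub hg2)
  have h1 : expEnt μ g ≤ ∫ q, Real.exp (g q.1) * (g q.1 - g q.2) ∂(μ.prod μ) := by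
    have e1 : ∫ q, Real.exp (g q.1) * (g q.1 - g q.2) ∂(μ.prod μ) =
        ∫ x, Real.exp (g x) * g x ∂μ - (∫ x, Real.exp (g x) ∂μ) * ∫ x, g x ∂μ := by
      simp_rw [mul_sub]
      rw [integral_sub ((hg1.exp.mul hg1).integrable _) ((hg1.exp.mul hg2).integrable _),
        integral_prod_mul (fun x => Real.exp (g x)) g]
      congr 1
      simpa using integral_fun_fst (μ := μ) (ν := μ) (fun x => Real.exp (g x) * g x)
    rw [e1]
    unfold expEnt
    have := mul_le_mul_of_nonneg_left hjensen hpos.le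
    linarith
  have hswap : ∀ F : α × α → ℝ, ∫ q, F q.swap ∂(μ.prod μ) = ∫ q, F q ∂(μ.prod μ) :=
    fun F => integral_prod_swap F
  have h2 : ∫ q, Real.exp (g q.1) * (g q.1 - g q.2) ∂(μ.prod μ) ≤
      ∫ q, Real.exp (g q.1) * (max (g q.1 - g q.2) 0) ^ 2 ∂(μ.prod μ) := by
    have hs1 := hswap (fun q => Real.exp (g q.1) * (g q.1 - g q.2))
    have hs2 := hswap (fun q => Real.exp (g q.1) * (max (g q.1 - g q.2) 0) ^ 2)
    have hle : ∫ q, (Real.exp (g q.1) * (g q.1 - g q.2) +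
          Real.exp (g q.swap.1) * (g q.swap.1 - g q.swap.2)) ∂(μ.prod μ) ≤
        ∫ q, (Real.exp (g q.1) * (max (g q.1 - g q.2) 0) ^ 2 +
          Real.exp (g q.swap.1) * (max (g q.swap.1 - g q.swap.2) 0) ^ 2) ∂(μ.prod μ) := by
      refine integral_mono ((hE.add (hE.comp measurable_swap)).integrable _)
        ((hD.add (hD.comp measurable_swap)).integrable _) fun q => ?_
      -- After symmetrising under the swap the integrand is `(exp a - exp b) (a - b)`, and `exp a -
      -- exp b ≤ exp a (a - b)`. Only the larger value keeps its weight, whence the positive part.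
      have aux : ∀ a b : ℝ, b ≤ a → Real.exp a * (a - b) + Real.exp b * (b - a) ≤
          Real.exp a * (a - b) ^ 2 := by
        intro a b hab
        have h := Real.add_one_le_exp (b - a)
        have h' : Real.exp b = Real.exp a * Real.exp (b - a) := by
          rw [← Real.exp_add]; congr 1; ring
        have h3 : Real.exp a - Real.exp b ≤ Real.exp a * (a - b) := by
          rw [h']; nlinarith [Real.exp_pos a]
        nlinarith
      simp only [Prod.fst_swap, Prod.snd_swap]
      rcases le_total (g q.1) (g q.2) with h | h
      · rw [max_eq_right (by linarith : g q.1 - g q.2 ≤ 0),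
          max_eq_left (by linarith : 0 ≤ g q.2 - g q.1)]
        have := aux _ _ h
        linarith
      · rw [max_eq_left (by linarith : 0 ≤ g q.1 - g q.2),
          max_eq_right (by linarith : g q.2 - g q.1 ≤ 0)]
        have := aux _ _ h
        linarith
    rw [integral_add (hE.integrable _) ((hE.comp measurable_swap).integrable _),
      integral_add (hD.integrable _) ((hD.comp measurable_swap).integrable _), hs1, hs2] at hle
    linarith
  refine (h1.trans h2).trans_eq ?_
  rw [integral_prod _ (hD.integrable _)]
  simp only [integral_const_mul]

/-- Subadditivity of the entropy over two independent variables. -/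
lemma expEnt_prod_le (μ : Measure α) [IsProbabilityMeasure μ] (ν : Measure β)
    [IsProbabilityMeasure ν] {g : α × β → ℝ} (hg : BddMeas g) :
    expEnt (μ.prod ν) g ≤ ∫ y, expEnt μ (fun x => g (x, y)) ∂ν +
      ∫ x, expEnt ν (fun y => g (x, y)) ∂μ := by
  have hgs : BddMeas (fun q : β × α => g (q.2, q.1)) := hg.comp measurable_swap
  -- The logarithm of the marginal density of `exp g`: testing the conditional entropies in `y`
  -- against it leaves exactly the entropies in `x`.
  set h : β → ℝ := fun y => Real.log (∫ x, Real.exp (g (x, y)) ∂μ) with hh_def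
  have hh : BddMeas h := hgs.log_integral_exp μ
  have hT : BddMeas (fun y => ∫ x, Real.exp (g (x, y)) ∂μ) := hgs.exp.integral_right μ
  have hexp : ∀ y, Real.exp (h y) = ∫ x, Real.exp (g (x, y)) ∂μ := fun y =>
    Real.exp_log (integral_exp_pos_of_bddMeas μ (hg.comp measurable_prodMk_right))
  set b := ∫ q, Real.exp (g q) ∂(μ.prod ν) with hb
  have hb1 : ∫ y, Real.exp (h y) ∂ν = b := by
    simp_rw [hexp, hb]
    exact (integral_prod_symm _ (hg.exp.integrable _)).symm
  have hb2 : ∫ x, ∫ y, Real.exp (g (x, y)) ∂ν ∂μ = b :=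
    (integral_prod _ (hg.exp.integrable _)).symm
  -- the variational inequality in the second variable
  have hx : ∀ x, ∫ y, Real.exp (g (x, y)) * h y ∂ν ≤ expEnt ν (fun y => g (x, y)) +
      (∫ y, Real.exp (g (x, y)) ∂ν) * Real.log b := fun x => by
    rw [← hb1]
    exact integral_exp_mul_le_expEnt_add ν (hg.comp measurable_prodMk_left) hh
  have hgh : BddMeas (fun q : α × β => Real.exp (g q) * h q.2) :=
    hg.exp.mul (hh.comp measurable_snd)
  have hI1 : BddMeas (fun x => expEnt ν (fun y => g (x, y))) :=
    ((hg.exp.mul hg).integral_right ν).sub ((hg.exp.integral_right ν).mul (hg.log_integral_exp ν))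
  have hI2 : BddMeas (fun x => (∫ y, Real.exp (g (x, y)) ∂ν) * Real.log b) :=
    (hg.exp.integral_right ν).mul (BddMeas.const _)
  have hxx := integral_mono ((hgh.integral_right ν).integrable μ) ((hI1.add hI2).integrable μ) hx
  rw [integral_add (hI1.integrable μ) (hI2.integrable μ), integral_mul_const, hb2,
    ← integral_prod _ (hgh.integrable _), integral_prod_symm _ (hgh.integrable _)] at hxx
  simp only [integral_mul_const] at hxx
  have hy : ∫ y, expEnt μ (fun x => g (x, y)) ∂ν = ∫ q, Real.exp (g q) * g q ∂(μ.prod ν) -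
      ∫ y, (∫ x, Real.exp (g (x, y)) ∂μ) * h y ∂ν := by
    rw [integral_prod_symm _ ((hg.exp.mul hg).integrable _), ← integral_sub
      (((hgs.exp.mul hgs).integral_right μ).integrable ν) ((hT.mul hh).integrable ν)]
    rfl
  rw [hy]
  unfold expEnt at *
  rw [← hb]
  linarith

end Entropy

/-! ### Tensorization over finite products. -/

section Tensorization

variable {α : Type*} [MeasurableSpace α]

lemma integral_pi_fin_succ {N : ℕ} (μ : Fin (N + 1) → Measure α)
    [∀ i, IsProbabilityMeasure (μ i)] (F : (Fin (N + 1) → α) → ℝ) :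
    ∫ x, F x ∂(Measure.pi μ) = ∫ q : α × (Fin N → α), F (Fin.cons q.1 q.2)
      ∂((μ 0).prod (Measure.pi fun j => μ j.succ)) := by
  rw [← ((measurePreserving_piFinSuccAbove μ 0).symm).integral_comp']
  simp [MeasurableEquiv.piFinSuccAbove_symm_apply, Fin.insertNthEquiv]

lemma measurable_fin_cons {N : ℕ} :
    Measurable (fun q : α × (Fin N → α) => (Fin.cons q.1 q.2 : Fin (N + 1) → α)) := by
  refine measurable_pi_lambda _ fun i => ?_
  refine Fin.cases ?_ (fun j => ?_) i
  · simpa using measurable_fst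
  · simp only [Fin.cons_succ]
    exact (measurable_pi_apply j).comp measurable_snd

lemma BddMeas.sq_posPart_update {ι : Type*} [Fintype ι] [DecidableEq ι] {g : (ι → α) → ℝ}
    (hg : BddMeas g) (i : ι) (ν : Measure α) [IsProbabilityMeasure ν] :
    BddMeas (fun x => ∫ y, (max (g x - g (Function.update x i y)) 0) ^ 2 ∂ν) := by
  have hu : Measurable (fun q : (ι → α) × α => Function.update q.1 i q.2) := by
    refine measurable_pi_lambda _ fun j => ?_
    by_cases h : j = i
    · subst h; simpa using measurable_snd
    · simp only [Function.update_of_ne h]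
      exact (measurable_pi_apply j).comp measurable_fst
  exact (((hg.comp measurable_fst).sub (hg.comp hu)).posPart.pow 2).integral_right
    (G := fun q : (ι → α) × α => (max (g q.1 - g (Function.update q.1 i q.2)) 0) ^ 2) ν

/-- Induction on the number of variables: subadditivity splits off coordinate `0`, which is handled
by the one-variable bound, while the others fall to the induction hypothesis with coordinate `0`
frozen. -/
lemma expEnt_pi_fin_le {N : ℕ} (μ : Fin N → Measure α) [∀ i, IsProbabilityMeasure (μ i)]
    {g : (Fin N → α) → ℝ} (hg : BddMeas g) :
    expEnt (Measure.pi μ) g ≤ ∑ i, ∫ x, Real.exp (g x) *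
      ∫ y, (max (g x - g (Function.update x i y)) 0) ^ 2 ∂(μ i) ∂(Measure.pi μ) := by
  induction N with
  | zero => simp [expEnt, integral_unique, measureReal_def, mul_comm]
  | succ N ih =>
    set ν := Measure.pi fun j : Fin N => μ j.succ with hν
    set g' : α × (Fin N → α) → ℝ := fun q => g (Fin.cons q.1 q.2) with hg'
    have hgm : BddMeas g' := hg.comp measurable_fin_cons
    have h0 : expEnt (Measure.pi μ) g = expEnt ((μ 0).prod ν) g' := by
      unfold expEnt
      rw [integral_pi_fin_succ μ (fun x => Real.exp (g x) * g x),
        integral_pi_fin_succ μ (fun x => Real.exp (g x))]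
    rw [h0, Fin.sum_univ_succ]
    refine (expEnt_prod_le (μ 0) ν hgm).trans (add_le_add ?_ ?_)
    · rw [integral_pi_fin_succ μ]
      have hD := (hg.exp.mul (hg.sq_posPart_update 0 (μ 0))).comp (measurable_fin_cons (α := α))
      rw [integral_prod_symm _ (hD.integrable _)]
      have hD' := hD.comp (measurable_swap (α := Fin N → α) (β := α))
      have hgs : BddMeas (fun q : (Fin N → α) × α => g' (q.2, q.1)) := hgm.comp measurable_swap
      refine integral_mono ?_ ((hD'.integral_right (μ 0)).integrable ν) fun x => ?_
      · exact (((hgs.exp.mul hgs).integral_right (μ 0)).sub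
          ((hgs.exp.integral_right (μ 0)).mul (hgs.log_integral_exp (μ 0)))).integrable ν
      · refine (expEnt_le_integral_sq (μ 0)
          (hgm.comp (measurable_prodMk_right (y := x)))).trans_eq ?_
        simp [hg']
    · have hD : ∀ j : Fin N, BddMeas _ := fun j =>
        (hg.exp.mul (hg.sq_posPart_update j.succ (μ j.succ))).comp (measurable_fin_cons (α := α))
      have hsum : ∀ j : Fin N, ∫ x, Real.exp (g x) *
          ∫ y, (max (g x - g (Function.update x j.succ y)) 0) ^ 2 ∂(μ j.succ) ∂(Measure.pi μ) =
          ∫ a, ∫ x, Real.exp (g' (a, x)) * ∫ y, (max (g' (a, x) -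
            g' (a, Function.update x j y)) 0) ^ 2 ∂(μ j.succ) ∂ν ∂(μ 0) := fun j => by
        rw [integral_pi_fin_succ μ, integral_prod _ ((hD j).integrable _)]
        simp [hg', Fin.cons_update, hν]
      simp_rw [hsum]
      have hDi : ∀ j : Fin N, BddMeas (fun a => ∫ x, Real.exp (g' (a, x)) *
          ∫ y, (max (g' (a, x) - g' (a, Function.update x j y)) 0) ^ 2 ∂(μ j.succ) ∂ν) := by
        intro j
        have := (hD j).integral_right ν
        simpa [hg', Fin.cons_update] using this
      rw [← integral_finsetSum _ fun j _ => (hDi j).integrable _]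
      refine integral_mono ?_ ((BddMeas.sum _ fun j _ => hDi j).integrable _) fun a => ?_
      · exact (((hgm.exp.mul hgm).integral_right ν).sub
          ((hgm.exp.integral_right ν).mul (hgm.log_integral_exp ν))).integrable (μ 0)
      · exact ih (fun j => μ j.succ) (hgm.comp (measurable_prodMk_left (x := a)))

/-- Tensorization of the entropy over finitely many independent variables. -/
lemma expEnt_pi_le {ι : Type*} [Fintype ι] [DecidableEq ι] (μ : ι → Measure α)
    [∀ i, IsProbabilityMeasure (μ i)] {g : (ι → α) → ℝ} (hg : BddMeas g) :
    expEnt (Measure.pi μ) g ≤ ∫ x, Real.exp (g x) *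
      ∑ i, ∫ y, (max (g x - g (Function.update x i y)) 0) ^ 2 ∂(μ i) ∂(Measure.pi μ) := by
  let e := (Fintype.equivFin ι).symm
  have hE : ∀ x : Fin (Fintype.card ι) → α,
      (MeasurableEquiv.piCongrLeft (fun _ : ι => α) e) x = x ∘ e.symm := by
    intro x
    ext i
    obtain ⟨j, rfl⟩ := e.surjective i
    simp [MeasurableEquiv.coe_piCongrLeft, Equiv.piCongrLeft_apply_apply]
  have hI : ∀ F : (ι → α) → ℝ, ∫ x, F x ∂(Measure.pi μ) =
      ∫ x, F (x ∘ e.symm) ∂(Measure.pi fun i => μ (e i)) := fun F => by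
    rw [← (measurePreserving_piCongrLeft μ e).integral_comp']
    simp_rw [hE]
  have hmeas : Measurable (fun x : Fin (Fintype.card ι) → α => x ∘ e.symm) :=
    measurable_pi_lambda _ fun i => measurable_pi_apply (e.symm i)
  have h := expEnt_pi_fin_le (fun i => μ (e i)) (hg.comp hmeas)
  have h0 : expEnt (Measure.pi fun i => μ (e i)) (fun x => g (x ∘ e.symm)) =
      expEnt (Measure.pi μ) g := by
    unfold expEnt
    rw [hI (fun x => Real.exp (g x) * g x), hI (fun x => Real.exp (g x))]
  rw [h0] at h
  refine h.trans_eq ?_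
  simp_rw [Finset.mul_sum]
  rw [integral_finsetSum _ fun i _ => (hg.exp.mul (hg.sq_posPart_update i (μ i))).integrable _,
    ← e.sum_comp]
  refine Finset.sum_congr rfl fun i _ => ?_
  rw [hI]
  have hup : ∀ (x : Fin (Fintype.card ι) → α) y,
      Function.update x i y ∘ e.symm = Function.update (x ∘ e.symm) (e i) y := by
    intro x y
    rw [Function.update_comp_equiv]
    simp
  simp_rw [hup]

end Tensorization

/-! ### From entropy bounds to exponential moments. -/

section Herbst

/-- The Herbst argument. -/
lemma log_integral_exp_le_of_expEnt_le {α : Type*} [MeasurableSpace α] (μ : Measure α)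
    [IsProbabilityMeasure μ] {g : α → ℝ} (hg : BddMeas g) {C s : ℝ} (hs : 0 < s)
    (h : ∀ r, 0 < r → r ≤ s →
      expEnt μ (fun x => r * g x) ≤ C * r ^ 2 * ∫ x, Real.exp (r * g x) ∂μ) :
    Real.log (∫ x, Real.exp (s * g x) ∂μ) ≤ s * ∫ x, g x ∂μ + C * s ^ 2 := by
  have huniv : ∀ r, r ∈ interior (integrableExpSet g μ) := by
    have : integrableExpSet g μ = Set.univ :=
      Set.eq_univ_of_forall fun r => (hg.const_mul r).exp.integrable μ
    simp [this]
  have hdiff : ∀ r, HasDerivAt (cgf g μ)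
      ((∫ x, g x * Real.exp (r * g x) ∂μ) / mgf g μ r) r := fun r => by
    rw [← deriv_cgf (huniv r)]
    exact (analyticAt_cgf (huniv r)).differentiableAt.hasDerivAt
  have hpos : ∀ r, 0 < mgf g μ r := fun r => integral_exp_pos_of_bddMeas μ (hg.const_mul r)
  -- The derivative of `cgf r / r` is the entropy of `exp (r g)` divided by `r²` times its mean, so
  -- the hypothesis makes `u` decreasing; its limit at `0` is the mean of `g`.
  set u : ℝ → ℝ := fun r => cgf g μ r / r - C * r with hu
  have hud : ∀ r, 0 < r → HasDerivAt u
      (((∫ x, g x * Real.exp (r * g x) ∂μ) / mgf g μ r * r - cgf g μ r * 1) / r ^ 2 - C * 1) r :=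
    fun r hr => ((hdiff r).div (hasDerivAt_id r) hr.ne').sub ((hasDerivAt_id r).const_mul C)
  have hanti : AntitoneOn u (Set.Ioc 0 s) := by
    refine antitoneOn_of_deriv_nonpos (convex_Ioc 0 s)
      (fun r hr => (hud r hr.1).continuousAt.continuousWithinAt)
      (fun r hr => (hud r (interior_subset hr).1).differentiableAt.differentiableWithinAt)
      fun r hr => ?_
    have hr' := interior_subset hr
    have hr0 := hr'.1
    rw [(hud r hr0).deriv]
    have hE := h r hr0 hr'.2
    have hexp : expEnt μ (fun x => r * g x) =
        r * (∫ x, g x * Real.exp (r * g x) ∂μ) - mgf g μ r * cgf g μ r := by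
      unfold expEnt
      rw [← integral_const_mul]
      simp only [mgf, cgf]
      congr 2
      ext x
      ring
    rw [hexp] at hE
    have hE' : r * (∫ x, g x * Real.exp (r * g x) ∂μ) - mgf g μ r * cgf g μ r ≤
        C * r ^ 2 * mgf g μ r := hE
    have h1 : (∫ x, g x * Real.exp (r * g x) ∂μ) / mgf g μ r * r - cgf g μ r * 1 ≤ C * r ^ 2 := by
      have : (∫ x, g x * Real.exp (r * g x) ∂μ) / mgf g μ r * r - cgf g μ r * 1 =
          (r * (∫ x, g x * Real.exp (r * g x) ∂μ) - mgf g μ r * cgf g μ r) / mgf g μ r := by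
        rw [sub_div, mul_div_assoc, mul_comm, mul_one, mul_div_cancel_left₀ _ (hpos r).ne']
      rw [this, div_le_iff₀ (hpos r)]
      exact hE'
    have h2 := (div_le_iff₀ (pow_pos hr0 2)).2 h1
    linarith
  have hlim : Filter.Tendsto u (nhdsWithin 0 (Set.Ioi 0)) (nhds (∫ x, g x ∂μ)) := by
    have h1 := (hdiff 0).tendsto_slope
    have h2 : Filter.Tendsto (slope (cgf g μ) 0) (nhdsWithin 0 (Set.Ioi 0))
        (nhds (∫ x, g x ∂μ)) := by
      have := h1.mono_left (nhdsWithin_mono (0 : ℝ) (s := Set.Ioi 0) (t := {0}ᶜ)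
        fun r hr => (Set.mem_Ioi.1 hr).ne')
      simpa using this
    have h3 : Filter.Tendsto (fun r : ℝ => C * r) (nhdsWithin 0 (Set.Ioi 0)) (nhds 0) := by
      have : Filter.Tendsto (fun r : ℝ => C * r) (nhds 0) (nhds (C * 0)) :=
        (continuous_const.mul continuous_id).tendsto 0
      simpa using this.mono_left nhdsWithin_le_nhds
    have := h2.sub h3
    rw [sub_zero] at this
    refine this.congr fun r => ?_
    simp [hu, slope_def_field]
  have hle : u s ≤ ∫ x, g x ∂μ := by
    refine ge_of_tendsto hlim ?_
    filter_upwards [Ioc_mem_nhdsGT hs] with r hr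
    exact hanti hr ⟨hs, le_rfl⟩ hr.2
  have : cgf g μ s / s ≤ ∫ x, g x ∂μ + C * s := by simp only [hu] at hle; linarith
  rw [div_le_iff₀ hs] at this
  have h4 : Real.log (∫ x, Real.exp (s * g x) ∂μ) = cgf g μ s := rfl
  rw [h4]
  linarith

/-- An exponential Efron–Stein inequality: if the one-sided squared increments of `g` sum up to at
most `V`, then exponential moments of `V` control those of `g - E g`. -/
theorem log_integral_exp_le_of_sum_sq_le {ι α : Type*} [Fintype ι] [DecidableEq ι]
    [MeasurableSpace α] (μ : ι → Measure α) [∀ i, IsProbabilityMeasure (μ i)]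
    {g V : (ι → α) → ℝ} (hg : BddMeas g) (hV : BddMeas V)
    (hgV : ∀ x, ∑ i, ∫ y, (max (g x - g (Function.update x i y)) 0) ^ 2 ∂(μ i) ≤ V x)
    {C s : ℝ} (hs : 0 < s)
    (hC : ∀ r, 0 < r → r ≤ s →
      Real.log (∫ x, Real.exp (2 * r ^ 2 * V x) ∂(Measure.pi μ)) ≤ C * r ^ 2) :
    Real.log (∫ x, Real.exp (s * g x) ∂(Measure.pi μ)) ≤
      s * ∫ x, g x ∂(Measure.pi μ) + C * s ^ 2 := by
  refine log_integral_exp_le_of_expEnt_le _ hg hs fun r hr hrs => ?_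
  set P := Measure.pi μ
  have hrg := hg.const_mul r
  have h1 := expEnt_pi_le μ hrg
  have h2 : ∫ x, Real.exp (r * g x) * ∑ i, ∫ y, (max (r * g x -
      r * g (Function.update x i y)) 0) ^ 2 ∂(μ i) ∂P ≤
      ∫ x, Real.exp (r * g x) * (r ^ 2 * V x) ∂P := by
    refine integral_mono ((hrg.exp.mul (BddMeas.sum _ fun i _ =>
      hrg.sq_posPart_update i (μ i))).integrable P)
      ((hrg.exp.mul (hV.const_mul _)).integrable P) fun x => ?_
    refine mul_le_mul_of_nonneg_left ?_ (Real.exp_pos _).le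
    refine le_trans (le_of_eq ?_) (mul_le_mul_of_nonneg_left (hgV x) (sq_nonneg r))
    rw [Finset.mul_sum]
    refine Finset.sum_congr rfl fun i _ => ?_
    rw [← integral_const_mul]
    congr 1
    ext y
    rw [← mul_sub, ← mul_pow, mul_max_of_nonneg _ _ hr.le, mul_zero]
  -- The factor `2` makes the left side twice the upper bound of the entropy, so the entropy on the
  -- right can be absorbed.
  have h3 := integral_exp_mul_le_expEnt_add P hrg (hV.const_mul (2 * r ^ 2))
  have h4 : ∫ x, Real.exp (r * g x) * (2 * r ^ 2 * V x) ∂P =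
      2 * ∫ x, Real.exp (r * g x) * (r ^ 2 * V x) ∂P := by
    rw [← integral_const_mul]
    congr 1
    ext x
    ring
  have h5 := mul_le_mul_of_nonneg_left (hC r hr hrs) (integral_exp_pos_of_bddMeas P hrg).le
  rw [h4] at h3
  linarith

end Herbst

/-! ### Quadratic forms of a nonnegative matrix at delocalised vectors -/

/-- A weight vector bounded by `1 / m` and of total mass at most `1` is dominated by the uniform
weight on some set of at most `2 m` points. -/
lemma exists_finset_sum_mul_le {ι : Type*} [Fintype ι] {m : ℝ} (hm : 1 ≤ m) (w Z : ι → ℝ)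
    (hw0 : ∀ i, 0 ≤ w i) (hw : ∀ i, w i ≤ 1 / m) (hsum : ∑ i, w i ≤ 1) (hZ : ∀ i, 0 ≤ Z i) :
    ∃ A : Finset ι, (A.card : ℝ) ≤ 2 * m ∧ ∑ i, w i * Z i ≤ 1 / m * ∑ i ∈ A, Z i := by
  classical
  have hm0 : 0 < m := by linarith
  have hMle : (⌈m⌉₊ : ℝ) ≤ 2 * m := by
    have := (Nat.ceil_lt_add_one hm0.le).le
    linarith
  rcases le_or_gt (Fintype.card ι) ⌈m⌉₊ with hcard | hcard
  · refine ⟨Finset.univ, le_trans (by exact_mod_cast hcard) hMle, ?_⟩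
    rw [Finset.mul_sum]
    exact Finset.sum_le_sum fun i _ => mul_le_mul_of_nonneg_right (hw i) (hZ i)
  · have hne : (Finset.powersetCard ⌈m⌉₊ (Finset.univ : Finset ι)).Nonempty :=
      Finset.powersetCard_nonempty.2 (by simpa using hcard.le)
    obtain ⟨A, hA, hAmax⟩ := Finset.exists_max_image _ (fun A => ∑ i ∈ A, Z i) hne
    have hAc : A.card = ⌈m⌉₊ := (Finset.mem_powersetCard.1 hA).2
    have hAne : A.Nonempty := by
      rw [← Finset.card_pos, hAc]
      exact Nat.ceil_pos.2 hm0
    obtain ⟨i₀, hi₀, hmin⟩ := Finset.exists_min_image A Z hAne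
    have hout : ∀ j, j ∉ A → Z j ≤ Z i₀ := by
      intro j hj
      have hj' : j ∉ A.erase i₀ := fun h => hj (Finset.mem_of_mem_erase h)
      have hmem : insert j (A.erase i₀) ∈ Finset.powersetCard ⌈m⌉₊ (Finset.univ : Finset ι) := by
        rw [Finset.mem_powersetCard]
        refine ⟨Finset.subset_univ _, ?_⟩
        rw [Finset.card_insert_of_notMem hj', Finset.card_erase_of_mem hi₀, hAc]
        have := Nat.ceil_pos.2 hm0
        omega
      have := hAmax _ hmem
      rw [Finset.sum_insert hj', ← Finset.add_sum_erase A Z hi₀] at this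
      linarith
    refine ⟨A, by rw [hAc]; exact hMle, ?_⟩
    -- Bathtub principle: `Z i₀` separates the values of `Z` on the optimal set `A` from those
    -- outside. The subtracted constant is restored because the weights have mass at most `1 ≤ ⌈m⌉ /
    -- m`.
    have h1 : ∑ i, w i * (Z i - Z i₀) ≤ ∑ i ∈ A, 1 / m * (Z i - Z i₀) := by
      rw [← Finset.sum_add_sum_compl A]
      have hA1 : ∑ i ∈ A, w i * (Z i - Z i₀) ≤ ∑ i ∈ A, 1 / m * (Z i - Z i₀) :=
        Finset.sum_le_sum fun i hi =>
          mul_le_mul_of_nonneg_right (hw i) (sub_nonneg.2 (hmin i hi))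
      have hA2 : ∑ i ∈ Aᶜ, w i * (Z i - Z i₀) ≤ 0 :=
        Finset.sum_nonpos fun i hi => mul_nonpos_of_nonneg_of_nonpos (hw0 i)
          (sub_nonpos.2 (hout i (Finset.mem_compl.1 hi)))
      linarith
    have h2 : ∑ i, w i * (Z i - Z i₀) = ∑ i, w i * Z i - (∑ i, w i) * Z i₀ := by
      simp_rw [mul_sub, Finset.sum_sub_distrib, Finset.sum_mul]
    have h3 : ∑ i ∈ A, 1 / m * (Z i - Z i₀) = 1 / m * ∑ i ∈ A, Z i - ⌈m⌉₊ / m * Z i₀ := by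
      rw [← Finset.mul_sum, Finset.sum_sub_distrib, Finset.sum_const, hAc, nsmul_eq_mul]
      ring
    have h4 : 1 ≤ ⌈m⌉₊ / m := by
      rw [le_div_iff₀ hm0, one_mul]
      exact Nat.le_ceil m
    have h5 := mul_le_mul_of_nonneg_right h4 (hZ i₀)
    have h6 := mul_le_mul_of_nonneg_right hsum (hZ i₀)
    linarith

/-- Weighted exponential sum over all pairs of subsets of sizes at most `2 m` and `2 b`. -/
noncomputable def blockSum {n : ℕ} (m b y x θ : ℝ) (ξ : Fin n → Fin n → ℝ) : ℝ :=
  ∑ A : Finset (Fin n) with (A.card : ℝ) ≤ 2 * m, ∑ B : Finset (Fin n) with (B.card : ℝ) ≤ 2 * b,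
    y ^ A.card * x ^ B.card * Real.exp (θ * ∑ i ∈ A, ∑ j ∈ B, ξ i j)

/-- The vector with entries `2 ^ a i * η`, or `0` where `a i = 0`. -/
noncomputable def dyadicVec {n N : ℕ} (η : ℝ) (a : Fin n → Fin N) (i : Fin n) : ℝ :=
  if (a i : ℕ) = 0 then 0 else 2 ^ (a i : ℕ) * η

/-- Truncated weights `θ (u i u j / κ) ^ 2`. -/
noncomputable def truncWeight {n : ℕ} (θ κ : ℝ) (u : Fin n → ℝ) (i j : Fin n) : ℝ :=
  if u i * u j ≤ κ then θ * (u i * u j / κ) ^ 2 else 0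

/-- Weighted exponential sum over all dyadic vectors of squared norm at most `4` with entries
above `η`. -/
noncomputable def levelSum {n : ℕ} (N : ℕ) (η κ x θ : ℝ) (ξ : Fin n → Fin n → ℝ) : ℝ :=
  ∑ a : Fin n → Fin N with ∑ i, dyadicVec η a i ^ 2 ≤ 4,
    x ^ (∑ i, (a i : ℕ)) * Real.exp (∑ i, ∑ j, truncWeight θ κ (dyadicVec η a) i j * ξ i j)

lemma truncWeight_nonneg {n : ℕ} {θ : ℝ} (hθ : 0 ≤ θ) (κ : ℝ) (u : Fin n → ℝ) (i j : Fin n) :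
    0 ≤ truncWeight θ κ u i j := by
  unfold truncWeight
  split_ifs
  · positivity
  · exact le_rfl

lemma dyadicVec_nonneg {n N : ℕ} {η : ℝ} (hη : 0 ≤ η) (a : Fin n → Fin N) (i : Fin n) :
    0 ≤ dyadicVec η a i := by
  unfold dyadicVec
  split_ifs
  · exact le_rfl
  · positivity

/-- The pair of empty sets contributes `1`. This makes the logarithm nonnegative and bounded. -/
lemma one_le_blockSum {n : ℕ} {m b y x θ : ℝ} (hm : 0 ≤ m) (hb : 0 ≤ b) (hy : 0 ≤ y)
    (hx : 0 ≤ x) (ξ : Fin n → Fin n → ℝ) : 1 ≤ blockSum m b y x θ ξ := by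
  unfold blockSum
  have h1 : (1 : ℝ) ≤ ∑ B : Finset (Fin n) with (B.card : ℝ) ≤ 2 * b,
      y ^ (∅ : Finset (Fin n)).card * x ^ B.card *
        Real.exp (θ * ∑ i ∈ (∅ : Finset (Fin n)), ∑ j ∈ B, ξ i j) := by
    refine le_trans (by simp) (Finset.single_le_sum (f := fun B : Finset (Fin n) =>
      y ^ (∅ : Finset (Fin n)).card * x ^ B.card *
        Real.exp (θ * ∑ i ∈ (∅ : Finset (Fin n)), ∑ j ∈ B, ξ i j)) (fun B _ => by positivity)
      (a := ∅) (by simpa using hb))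
  exact h1.trans (Finset.single_le_sum (f := fun A : Finset (Fin n) =>
    ∑ B : Finset (Fin n) with (B.card : ℝ) ≤ 2 * b, y ^ A.card * x ^ B.card *
      Real.exp (θ * ∑ i ∈ A, ∑ j ∈ B, ξ i j))
    (fun A _ => Finset.sum_nonneg fun B _ => by positivity) (a := ∅) (by simpa using hm))

lemma one_le_levelSum {n N : ℕ} (hN : 0 < N) {η κ x θ : ℝ} (hx : 0 ≤ x)
    (ξ : Fin n → Fin n → ℝ) : 1 ≤ levelSum N η κ x θ ξ := by
  unfold levelSum
  have hu : ∀ i, dyadicVec η (fun _ : Fin n => (⟨0, hN⟩ : Fin N)) i = 0 := by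
    intro i; simp [dyadicVec]
  refine le_trans ?_ (Finset.single_le_sum (f := fun a : Fin n → Fin N =>
    x ^ (∑ i, (a i : ℕ)) * Real.exp (∑ i, ∑ j, truncWeight θ κ (dyadicVec η a) i j * ξ i j))
    (fun a _ => by positivity) (a := fun _ => ⟨0, hN⟩) (by simp [hu]))
  simp [truncWeight, hu]

/-- The bathtub lemma, applied to each argument of the bilinear form in turn, replaces the weights
by sets `A` and `B`. The term of the exponential sum at `(A, B)` lies below the whole sum, and the
two logarithms of weights are its entropy cost. The bound holds for every `ξ`. -/
lemma blockForm_le {n : ℕ} {m b y x θ : ℝ} (hm : 1 ≤ m) (hb : 1 ≤ b) (hy : 0 < y) (hy1 : y ≤ 1)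
    (hx : 0 < x) (hx1 : x ≤ 1) (hθ : 0 ≤ θ) {ξ : Fin n → Fin n → ℝ} (hξ : ∀ i j, 0 ≤ ξ i j)
    {w w' : Fin n → ℝ} (hw0 : ∀ i, 0 ≤ w i) (hw : ∀ i, w i ≤ 1 / m) (hws : ∑ i, w i ≤ 1)
    (hw0' : ∀ i, 0 ≤ w' i) (hw' : ∀ i, w' i ≤ 1 / b) (hws' : ∑ i, w' i ≤ 1) :
    m * b * θ * ∑ i, ∑ j, w i * w' j * ξ i j ≤
      Real.log (blockSum m b y x θ ξ) + 2 * m * Real.log (1 / y) + 2 * b * Real.log (1 / x) := by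
  have hm0 : 0 < m := by linarith
  have hb0 : 0 < b := by linarith
  obtain ⟨A, hAc, hA⟩ := exists_finset_sum_mul_le hm w (fun i => ∑ j, w' j * ξ i j) hw0 hw hws
    fun i => Finset.sum_nonneg fun j _ => mul_nonneg (hw0' j) (hξ i j)
  obtain ⟨B, hBc, hB⟩ := exists_finset_sum_mul_le hb w' (fun j => ∑ i ∈ A, ξ i j) hw0' hw' hws'
    fun j => Finset.sum_nonneg fun i _ => hξ i j
  have h1 : ∑ i, ∑ j, w i * w' j * ξ i j ≤ 1 / m * (1 / b * ∑ i ∈ A, ∑ j ∈ B, ξ i j) := by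
    have e1 : ∑ i, ∑ j, w i * w' j * ξ i j = ∑ i, w i * ∑ j, w' j * ξ i j := by
      simp_rw [Finset.mul_sum, mul_assoc]
    have e2 : ∑ i ∈ A, ∑ j, w' j * ξ i j = ∑ j, w' j * ∑ i ∈ A, ξ i j := by
      rw [Finset.sum_comm]
      simp_rw [Finset.mul_sum]
    have e3 : ∑ i ∈ A, ∑ j ∈ B, ξ i j = ∑ j ∈ B, ∑ i ∈ A, ξ i j := Finset.sum_comm
    rw [e1]
    refine hA.trans ?_
    rw [e2, e3]
    exact mul_le_mul_of_nonneg_left hB (by positivity)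
  have h2 : y ^ A.card * x ^ B.card * Real.exp (θ * ∑ i ∈ A, ∑ j ∈ B, ξ i j) ≤
      blockSum m b y x θ ξ := by
    unfold blockSum
    refine (Finset.single_le_sum (f := fun B : Finset (Fin n) =>
      y ^ A.card * x ^ B.card * Real.exp (θ * ∑ i ∈ A, ∑ j ∈ B, ξ i j))
      (s := Finset.univ.filter fun B : Finset (Fin n) => (B.card : ℝ) ≤ 2 * b)
      (fun B _ => by positivity) (by simpa using hBc)).trans ?_
    exact Finset.single_le_sum (f := fun A : Finset (Fin n) =>
      ∑ B : Finset (Fin n) with (B.card : ℝ) ≤ 2 * b, y ^ A.card * x ^ B.card *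
        Real.exp (θ * ∑ i ∈ A, ∑ j ∈ B, ξ i j))
      (fun A _ => Finset.sum_nonneg fun B _ => by positivity) (by simpa using hAc)
  have h3 := Real.log_le_log (by positivity) h2
  rw [Real.log_mul (by positivity) (Real.exp_pos _).ne', Real.log_mul (by positivity)
    (by positivity), Real.log_exp, Real.log_pow, Real.log_pow] at h3
  have hly : 0 ≤ -Real.log y := neg_nonneg.2 (Real.log_nonpos hy.le hy1)
  have hlx : 0 ≤ -Real.log x := neg_nonneg.2 (Real.log_nonpos hx.le hx1)
  have h4 := mul_le_mul_of_nonneg_right hAc hly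
  have h5 := mul_le_mul_of_nonneg_right hBc hlx
  have h6 := mul_le_mul_of_nonneg_left h1 (by positivity : 0 ≤ m * b * θ)
  have h7 : m * b * θ * (1 / m * (1 / b * ∑ i ∈ A, ∑ j ∈ B, ξ i j)) =
      θ * ∑ i ∈ A, ∑ j ∈ B, ξ i j := by field_simp
  rw [one_div y, one_div x, Real.log_inv, Real.log_inv]
  linarith

/-- Rounding each entry above `η` up to `2 ^ a η` at most doubles it. Products grow by at most `4`,
which turns the cutoff `κ / 4` into `κ` and the squared norm bound `1` into `4`. A single term of
`levelSum` then bounds the form, at the cost of at most `1 / η²` factors `x`. -/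
lemma levelForm_le {n N : ℕ} {η κ x θ : ℝ} (hη : 0 < η) (hκ : 0 < κ) (hx : 0 < x) (hx1 : x ≤ 1)
    (hθ : 0 ≤ θ) (hN : 1 / η + 1 < N) {ξ : Fin n → Fin n → ℝ} (hξ : ∀ i j, 0 ≤ ξ i j)
    {v : Fin n → ℝ} (hv0 : ∀ i, 0 ≤ v i) (hv : ∑ i, v i ^ 2 ≤ 1) :
    θ * ∑ i, ∑ j, (if η ≤ v i ∧ η ≤ v j ∧ v i * v j ≤ κ / 4 then
      (v i * v j / κ) ^ 2 * ξ i j else 0) ≤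
      Real.log (levelSum N η κ x θ ξ) + 1 / η ^ 2 * Real.log (1 / x) := by
  have hv1 : ∀ i, v i ≤ 1 := fun i => by
    have h1 := (Finset.single_le_sum (f := fun i => v i ^ 2) (fun i _ => sq_nonneg _)
      (Finset.mem_univ i)).trans hv
    exact (abs_le_one_iff_mul_self_le_one.2 (by simpa [sq] using h1) |> le_of_abs_le)
  have hex : ∀ i, ∃ a : Fin N, (v i < η → (a : ℕ) = 0) ∧
      (η ≤ v i → (a : ℕ) ≠ 0 ∧ v i ≤ 2 ^ (a : ℕ) * η ∧ 2 ^ (a : ℕ) * η ≤ 2 * v i) := by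
    intro i
    rcases lt_or_ge (v i) η with h | h
    · have hN0 : 0 < N := by
        have : (0 : ℝ) < N := lt_trans (by positivity) hN
        exact_mod_cast this
      exact ⟨⟨0, hN0⟩, fun _ => rfl, fun h' => absurd h' (not_le.2 h)⟩
    · obtain ⟨k, hk1, hk2⟩ := exists_nat_pow_near (x := v i / η) (y := (2 : ℝ))
        ((one_le_div hη).2 h) (by norm_num)
      rw [le_div_iff₀ hη] at hk1
      rw [div_lt_iff₀ hη] at hk2
      -- Entries are at most `1`, so `k < 2 ^ k ≤ 1 / η`. The exponent is shifted by one because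
      -- index `0` encodes entries below `η`.
      have hkN : k + 1 < N := by
        have h1 : (k : ℝ) < 2 ^ k := by exact_mod_cast Nat.lt_two_pow_self
        have h2 : (2 : ℝ) ^ k ≤ 1 / η := by
          rw [le_div_iff₀ hη]
          exact hk1.trans (hv1 i)
        have : ((k + 1 : ℕ) : ℝ) < N := by push_cast; linarith
        exact_mod_cast this
      refine ⟨⟨k + 1, hkN⟩, fun h' => absurd h (not_le.2 h'), fun _ => ⟨by simp, hk2.le, ?_⟩⟩
      simp only [pow_succ]
      linarith
  choose a ha0 ha1 using hex
  have hu0 : ∀ i, v i < η → dyadicVec η a i = 0 := fun i hi => by simp [dyadicVec, ha0 i hi]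
  have hu1 : ∀ i, η ≤ v i → dyadicVec η a i = 2 ^ (a i : ℕ) * η := fun i hi => by
    simp [dyadicVec, (ha1 i hi).1]
  have hule : ∀ i, dyadicVec η a i ≤ 2 * v i := fun i => by
    rcases lt_or_ge (v i) η with h | h
    · rw [hu0 i h]; linarith [hv0 i]
    · rw [hu1 i h]; exact (ha1 i h).2.2
  have hun := dyadicVec_nonneg hη.le a
  have hnorm : ∑ i, dyadicVec η a i ^ 2 ≤ 4 := by
    calc ∑ i, dyadicVec η a i ^ 2 ≤ ∑ i, 4 * v i ^ 2 := Finset.sum_le_sum fun i _ => by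
          nlinarith [hule i, hun i, hv0 i]
      _ = 4 * ∑ i, v i ^ 2 := by rw [Finset.mul_sum]
      _ ≤ 4 := by linarith
  have hdeg : (∑ i, (a i : ℕ) : ℕ) ≤ 1 / η ^ 2 := by
    push_cast
    -- With `a i = k + 1`: `k + 1 ≤ 2 ^ k ≤ 4 ^ k` and `2 ^ k η ≤ v i`. Hence the total degree is at
    -- most the squared norm over `η²`.
    have hterm : ∀ i, ((a i : ℕ) : ℝ) ≤ v i ^ 2 / η ^ 2 := fun i => by
      rcases lt_or_ge (v i) η with h | h
      · rw [ha0 i h]; simp; positivity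
      · rw [le_div_iff₀ (by positivity)]
        obtain ⟨h1, -, h3⟩ := ha1 i h
        obtain ⟨k, hk⟩ := Nat.exists_eq_succ_of_ne_zero h1
        rw [hk] at h3 ⊢
        have h4 : ((k + 1 : ℕ) : ℝ) ≤ 2 ^ k := by exact_mod_cast Nat.lt_two_pow_self
        have h5 : (2 : ℝ) ^ k * η ≤ v i := by rw [Nat.succ_eq_add_one, pow_succ] at h3; linarith
        have h6 : (1 : ℝ) ≤ 2 ^ k := one_le_pow₀ (by norm_num)
        calc ((k.succ : ℕ) : ℝ) * η ^ 2 ≤ 2 ^ k * η ^ 2 := by gcongr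
          _ ≤ (2 ^ k) ^ 2 * η ^ 2 := by gcongr; nlinarith
          _ = (2 ^ k * η) ^ 2 := by ring
          _ ≤ v i ^ 2 := by gcongr
    calc ∑ i, ((a i : ℕ) : ℝ) ≤ ∑ i, v i ^ 2 / η ^ 2 := Finset.sum_le_sum fun i _ => hterm i
      _ = (∑ i, v i ^ 2) / η ^ 2 := by rw [Finset.sum_div]
      _ ≤ 1 / η ^ 2 := by gcongr
  have h2 : x ^ (∑ i, (a i : ℕ)) *
      Real.exp (∑ i, ∑ j, truncWeight θ κ (dyadicVec η a) i j * ξ i j) ≤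
      levelSum N η κ x θ ξ := by
    unfold levelSum
    exact Finset.single_le_sum (f := fun a : Fin n → Fin N => x ^ (∑ i, (a i : ℕ)) *
      Real.exp (∑ i, ∑ j, truncWeight θ κ (dyadicVec η a) i j * ξ i j))
      (fun a _ => by positivity) (by simpa using hnorm)
  have h3 := Real.log_le_log (by positivity) h2
  rw [Real.log_mul (by positivity) (Real.exp_pos _).ne', Real.log_exp, Real.log_pow] at h3
  have hlx : 0 ≤ -Real.log x := neg_nonneg.2 (Real.log_nonpos hx.le hx1)
  have h4 := mul_le_mul_of_nonneg_right hdeg hlx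
  have h5 : θ * ∑ i, ∑ j, (if η ≤ v i ∧ η ≤ v j ∧ v i * v j ≤ κ / 4 then
      (v i * v j / κ) ^ 2 * ξ i j else 0) ≤
      ∑ i, ∑ j, truncWeight θ κ (dyadicVec η a) i j * ξ i j := by
    simp_rw [Finset.mul_sum]
    refine Finset.sum_le_sum fun i _ => Finset.sum_le_sum fun j _ => ?_
    split_ifs with h
    · obtain ⟨hi, hj, hij⟩ := h
      have hle : dyadicVec η a i * dyadicVec η a j ≤ κ := by
        have := mul_le_mul (hule i) (hule j) (hun j) (by linarith [hv0 i])
        nlinarith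
      rw [truncWeight, if_pos hle, mul_assoc]
      refine mul_le_mul_of_nonneg_left (mul_le_mul_of_nonneg_right ?_ (hξ i j)) hθ
      have hi' : v i ≤ dyadicVec η a i := by rw [hu1 i hi]; exact (ha1 i hi).2.1
      have hj' : v j ≤ dyadicVec η a j := by rw [hu1 j hj]; exact (ha1 j hj).2.1
      have := hv0 i
      have := hv0 j
      gcongr
      exact hun i
    · rw [mul_zero]
      exact mul_nonneg (truncWeight_nonneg hθ _ _ _ _) (hξ i j)
  rw [one_div x, Real.log_inv]
  linarith

/-- The part of the quadratic form with squared weights carried by small products. -/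
lemma light_sum_le {n N : ℕ} {ε η y x θ : ℝ} (hε : 0 < ε) (hε1 : ε ≤ 1) (hη : 0 < η)
    (hη1 : η ≤ 1) (hy : 0 < y) (hy1 : y ≤ 1) (hx : 0 < x) (hx1 : x ≤ 1) (hθ : 0 < θ)
    (hN : 1 / η + 1 < N) {ξ : Fin n → Fin n → ℝ} (hξ : ∀ i j, 0 ≤ ξ i j)
    (hsymm : ∀ i j, ξ i j = ξ j i) {v : Fin n → ℝ} (hv0 : ∀ i, 0 ≤ v i) (hvε : ∀ i, v i ≤ ε)
    (hv : ∑ i, v i ^ 2 ≤ 1) :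
    ∑ i, ∑ j, (if v i * v j ≤ ε * η then (v i * v j) ^ 2 * ξ i j else 0) ≤
      (ε * η) ^ 2 / θ * (2 * (Real.log (blockSum (1 / ε ^ 2) (1 / η ^ 2) y x θ ξ)
        + 2 * (1 / ε ^ 2) * Real.log (1 / y) + 2 * (1 / η ^ 2) * Real.log (1 / x))
        + 64 * (Real.log (levelSum N η (8 * (ε * η)) x θ ξ) + 1 / η ^ 2 * Real.log (1 / x))) := by
  have hm : 1 ≤ 1 / ε ^ 2 := (one_le_div (by positivity)).2 (pow_le_one₀ hε.le hε1)
  have hb : 1 ≤ 1 / η ^ 2 := (one_le_div (by positivity)).2 (pow_le_one₀ hη.le hη1)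
  set w' : Fin n → ℝ := fun j => if v j ≤ η then v j ^ 2 else 0 with hw'
  have hw0' : ∀ j, 0 ≤ w' j := fun j => by simp only [hw']; split_ifs <;> positivity
  have hwle : ∀ j, w' j ≤ v j ^ 2 := fun j => by
    simp only [hw']; split_ifs
    · exact le_rfl
    · positivity
  have h1 := blockForm_le hm hb hy hy1 hx hx1 hθ.le hξ (w := fun i => v i ^ 2) (w' := w')
    (fun i => sq_nonneg _) (fun i => by
      rw [one_div_one_div]
      exact pow_le_pow_left₀ (hv0 i) (hvε i) 2) hv hw0'
    (fun j => by
      rw [one_div_one_div]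
      simp only [hw']
      split_ifs with h
      · exact pow_le_pow_left₀ (hv0 j) h 2
      · positivity)
    ((Finset.sum_le_sum fun j _ => hwle j).trans hv)
  have h2 := levelForm_le hη (by positivity : 0 < 8 * (ε * η)) hx hx1 hθ.le hN hξ hv0 hv
  set R := ∑ i, ∑ j, v i ^ 2 * w' j * ξ i j with hR
  set T := ∑ i, ∑ j, (if η ≤ v i ∧ η ≤ v j ∧ v i * v j ≤ 8 * (ε * η) / 4 then
      (v i * v j / (8 * (ε * η))) ^ 2 * ξ i j else 0) with hT
  have hR' : ∑ i, ∑ j, w' i * v j ^ 2 * ξ i j = R := by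
    rw [hR, Finset.sum_comm]
    refine Finset.sum_congr rfl fun i _ => Finset.sum_congr rfl fun j _ => ?_
    rw [hsymm j i]
    ring
  -- Either one of the two entries is at most `η`, giving a block form `R` (twice, by symmetry), or
  -- both are at least `η`, giving the level form `T`; `64` undoes the normalisation by `κ = 8 ε η`.
  have h3 : ∑ i, ∑ j, (if v i * v j ≤ ε * η then (v i * v j) ^ 2 * ξ i j else 0) ≤
      R + R + 64 * (ε * η) ^ 2 * T := by
    nth_rewrite 2 [← hR']
    rw [hR, hT]
    simp_rw [Finset.mul_sum, ← Finset.sum_add_distrib]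
    refine Finset.sum_le_sum fun i _ => Finset.sum_le_sum fun j _ => ?_
    have p1 : 0 ≤ v i ^ 2 * w' j * ξ i j := mul_nonneg (mul_nonneg (sq_nonneg _) (hw0' j)) (hξ i j)
    have p2 : 0 ≤ w' i * v j ^ 2 * ξ i j := mul_nonneg (mul_nonneg (hw0' i) (sq_nonneg _)) (hξ i j)
    have p3 : 0 ≤ 64 * (ε * η) ^ 2 * (if η ≤ v i ∧ η ≤ v j ∧ v i * v j ≤ 8 * (ε * η) / 4 then
        (v i * v j / (8 * (ε * η))) ^ 2 * ξ i j else 0) := by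
      have := hξ i j
      split_ifs <;> positivity
    by_cases h : v i * v j ≤ ε * η
    · rw [if_pos h]
      rcases le_total (v j) η with hj | hj
      · have : v i ^ 2 * w' j * ξ i j = (v i * v j) ^ 2 * ξ i j := by
          simp only [hw', if_pos hj]; ring
        linarith
      · rcases le_total (v i) η with hi | hi
        · have : w' i * v j ^ 2 * ξ i j = (v i * v j) ^ 2 * ξ i j := by
            simp only [hw', if_pos hi]; ring
          linarith
        · have hpos : 0 < ε * η := by positivity
          have hc : η ≤ v i ∧ η ≤ v j ∧ v i * v j ≤ 8 * (ε * η) / 4 := ⟨hi, hj, by linarith⟩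
          rw [if_pos hc] at p3 ⊢
          have : 64 * (ε * η) ^ 2 * ((v i * v j / (8 * (ε * η))) ^ 2 * ξ i j) =
              (v i * v j) ^ 2 * ξ i j := by
            field_simp
            ring
          linarith
    · rw [if_neg h]
      linarith
  refine h3.trans ?_
  have e1 : R = (ε * η) ^ 2 / θ * (1 / ε ^ 2 * (1 / η ^ 2) * θ * R) := by field_simp
  have e2 : 64 * (ε * η) ^ 2 * T = (ε * η) ^ 2 / θ * (64 * (θ * T)) := by field_simp
  calc R + R + 64 * (ε * η) ^ 2 * T = (ε * η) ^ 2 / θ *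
        (2 * (1 / ε ^ 2 * (1 / η ^ 2) * θ * R) + 64 * (θ * T)) := by
        rw [e2]; nth_rewrite 1 [e1]; nth_rewrite 2 [e1]; ring
    _ ≤ _ := by gcongr

lemma ite_le_sum_dyadic {c s : ℝ} (hs : 0 ≤ s) (Q : ℕ) :
    (if c < s then s else 0) ≤
      ∑ q ∈ Finset.range Q, (if 2 ^ q * c < s ∧ s ≤ 2 ^ (q + 1) * c then s else 0) +
        (if 2 ^ Q * c < s then s else 0) := by
  induction Q with
  | zero => simp
  | succ Q ih =>
    rw [Finset.sum_range_succ]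
    refine ih.trans ?_
    have : (if 2 ^ Q * c < s then s else 0) ≤
        (if 2 ^ Q * c < s ∧ s ≤ 2 ^ (Q + 1) * c then s else 0) +
          (if 2 ^ (Q + 1) * c < s then s else 0) := by
      by_cases h1 : 2 ^ Q * c < s
      · by_cases h2 : s ≤ 2 ^ (Q + 1) * c
        · simp [h1, h2, not_lt.2 h2]
        · simp [h1, h2, not_le.1 h2]
      · simp only [h1, false_and, if_false]
        split_ifs <;> simp [hs]
    linarith

/-- The part of the quadratic form carried by large products. -/
lemma heavy_sum_le {n N : ℕ} {ε η θ : ℝ} {x : ℕ → ℝ} (hε : 0 < ε) (hη : 0 < η)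
    (hx : ∀ q, 0 < x q) (hx1 : ∀ q, x q ≤ 1) (hθ : 0 < θ) (hN : 1 / η + 1 < N)
    {ξ : Fin n → Fin n → ℝ} (hξ : ∀ i j, 0 ≤ ξ i j) (hξ1 : ∀ i j, ξ i j ≤ 1)
    {v : Fin n → ℝ} (hv0 : ∀ i, 0 ≤ v i) (hvε : ∀ i, v i ≤ ε) (hv : ∑ i, v i ^ 2 ≤ 1) (Q : ℕ) :
    ∑ i, ∑ j, (if ε * η < v i * v j then v i * v j * ξ i j else 0) ≤
      ∑ q ∈ Finset.range Q, 128 * 2 ^ q * (ε * η) / θ *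
        (Real.log (levelSum N (2 ^ q * η) (8 * (2 ^ q * (ε * η))) (x q) θ ξ) +
          1 / (2 ^ q * η) ^ 2 * Real.log (1 / x q)) + 1 / (2 ^ Q * (ε * η)) := by
  have hp : 0 < ε * η := by positivity
  have hlevel : ∀ q, ∑ i, ∑ j, (if 2 ^ q * (ε * η) < v i * v j ∧
      v i * v j ≤ 2 ^ (q + 1) * (ε * η) then v i * v j else 0) * ξ i j ≤
      128 * 2 ^ q * (ε * η) / θ *
        (Real.log (levelSum N (2 ^ q * η) (8 * (2 ^ q * (ε * η))) (x q) θ ξ) +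
          1 / (2 ^ q * η) ^ 2 * Real.log (1 / x q)) := by
    intro q
    have h2q : (1 : ℝ) ≤ 2 ^ q := one_le_pow₀ (by norm_num)
    have hN' : 1 / (2 ^ q * η) + 1 < N := by
      have : 1 / (2 ^ q * η) ≤ 1 / η := one_div_le_one_div_of_le hη (by nlinarith)
      linarith
    have h := levelForm_le (by positivity : 0 < 2 ^ q * η)
      (by positivity : 0 < 8 * (2 ^ q * (ε * η))) (hx q) (hx1 q) hθ.le hN' hξ hv0 hv
    set z := (2 : ℝ) ^ q with hz
    have hz0 : 0 < z := by positivity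
    calc _ ≤ 128 * z * (ε * η) / θ * (θ * ∑ i, ∑ j, (if z * η ≤ v i ∧ z * η ≤ v j ∧
          v i * v j ≤ 8 * (z * (ε * η)) / 4 then
          (v i * v j / (8 * (z * (ε * η)))) ^ 2 * ξ i j else 0)) := by
          rw [← mul_assoc (_ / θ), div_mul_cancel₀ _ hθ.ne']
          simp_rw [Finset.mul_sum]
          refine Finset.sum_le_sum fun i _ => Finset.sum_le_sum fun j _ => ?_
          have hξij := hξ i j
          split_ifs with h1 h2 h2
          · have hc : z * (ε * η) ≤ v i * v j := h1.1.le
            have hs0 : 0 < v i * v j := lt_trans (by positivity) h1.1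
            have hs2 : v i * v j ≤ 2 * (z * (ε * η)) := by
              have := h1.2; rw [pow_succ] at this; linarith
            -- On a dyadic shell the product is comparable to its square divided by the shell size,
            -- so the quadratic weights of `levelSum` also control a linear form.
            have : v i * v j ≤ 128 * z * (ε * η) * (v i * v j / (8 * (z * (ε * η)))) ^ 2 := by
              have e : 128 * z * (ε * η) * (v i * v j / (8 * (z * (ε * η)))) ^ 2 =
                  2 * (v i * v j) ^ 2 / (z * (ε * η)) := by
                field_simp
                ring
              rw [e, le_div_iff₀ (by positivity)]
              nlinarith
            calc v i * v j * ξ i j ≤ _ := mul_le_mul_of_nonneg_right this hξij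
              _ = _ := by ring
          -- Since all entries are at most `ε`, an entry below `2 ^ q η` would force the product
          -- below the lower end of the shell.
          · exfalso
            apply h2
            have hs := h1.1
            refine ⟨?_, ?_, ?_⟩
            · by_contra hlt
              rw [not_le] at hlt
              have := mul_le_mul hlt.le (hvε j) (hv0 j) (by positivity)
              nlinarith
            · by_contra hlt
              rw [not_le] at hlt
              have := mul_le_mul (hvε i) hlt.le (hv0 j) hε.le
              nlinarith
            · have := h1.2; rw [pow_succ] at this; linarith
          · rw [zero_mul]; positivity
          · simp
      _ ≤ _ := by gcongr
  -- Above the last shell `s ≤ s² / (2 ^ Q ε η)`, and the squares sum to at most `1`; `ξ ≤ 1` is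
  -- enough here.
  have hlast : ∑ i, ∑ j, (if 2 ^ Q * (ε * η) < v i * v j then v i * v j else 0) * ξ i j ≤
      1 / (2 ^ Q * (ε * η)) := by
    calc _ ≤ ∑ i, ∑ j, v i ^ 2 * v j ^ 2 * (1 / (2 ^ Q * (ε * η))) := by
          refine Finset.sum_le_sum fun i _ => Finset.sum_le_sum fun j _ => ?_
          split_ifs with h
          · have hs0 : 0 < v i * v j := lt_trans (by positivity) h
            rw [mul_one_div, le_div_iff₀ (by positivity)]
            have h1 : v i * v j * ξ i j ≤ v i * v j := mul_le_of_le_one_right hs0.le (hξ1 i j)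
            calc v i * v j * ξ i j * (2 ^ Q * (ε * η)) ≤ v i * v j * (v i * v j) := by gcongr
              _ = _ := by ring
          · rw [zero_mul]; positivity
      _ = (∑ i, v i ^ 2) * (∑ j, v j ^ 2) * (1 / (2 ^ Q * (ε * η))) := by
          rw [Finset.sum_mul_sum, Finset.sum_mul]
          simp_rw [Finset.sum_mul]
      _ ≤ 1 * 1 * (1 / (2 ^ Q * (ε * η))) := by
          gcongr
      _ = _ := by ring
  refine le_trans ?_ (add_le_add (Finset.sum_le_sum fun q _ => hlevel q) hlast)
  rw [Finset.sum_comm (s := Finset.range Q)]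
  rw [← Finset.sum_add_distrib]
  refine Finset.sum_le_sum fun i _ => ?_
  rw [Finset.sum_comm (s := Finset.range Q), ← Finset.sum_add_distrib]
  refine Finset.sum_le_sum fun j _ => ?_
  rw [← Finset.sum_mul, ← add_mul]
  refine le_trans (le_of_eq ?_) (mul_le_mul_of_nonneg_right
    (ite_le_sum_dyadic (c := ε * η) (mul_nonneg (hv0 i) (hv0 j)) Q) (hξ i j))
  split_ifs <;> simp

/-! ### Exponential moments of the sums over blocks and levels for a sparse random matrix -/

/-- The index of the entry `(i, j)` of a symmetric matrix. -/
def edge {n : ℕ} (i j : Fin n) : UpperIndex n := ⟨(min i j, max i j), min_le_max⟩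

lemma edge_comm {n : ℕ} (i j : Fin n) : edge i j = edge j i := by
  simp [edge, min_comm, max_comm]

/-- The symmetric array with upper entries `z`. -/
def symArray {n : ℕ} (z : UpperIndex n → ℝ) (i j : Fin n) : ℝ := z (edge i j)

lemma symArray_comm {n : ℕ} (z : UpperIndex n → ℝ) (i j : Fin n) :
    symArray z i j = symArray z j i := by
  simp [symArray, edge_comm i j]

lemma card_edge_fiber_le {n : ℕ} (e : UpperIndex n) :
    (Finset.univ.filter fun q : Fin n × Fin n => edge q.1 q.2 = e).card ≤ 2 := by
  classical
  refine (Finset.card_le_card (t := {(e.1.1, e.1.2), (e.1.2, e.1.1)}) fun q hq => ?_).trans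
    Finset.card_le_two
  have h : edge q.1 q.2 = e := by simpa using hq
  rw [Finset.mem_insert, Finset.mem_singleton, ← h]
  rcases le_total q.1 q.2 with hle | hle
  · left; simp [edge, hle]
  · right; simp [edge, hle]

/-- Regroups a sum over ordered pairs by the independent entries, as needed to factor expectations.
-/
lemma sum_mul_symArray {n : ℕ} (c : Fin n → Fin n → ℝ) (z : UpperIndex n → ℝ) :
    ∑ i, ∑ j, c i j * symArray z i j =
      ∑ e, (∑ q : Fin n × Fin n with edge q.1 q.2 = e, c q.1 q.2) * z e := by
  rw [← Fintype.sum_prod_type' (fun i j => c i j * symArray z i j),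
    ← Finset.sum_fiberwise (s := Finset.univ) (g := fun q : Fin n × Fin n => edge q.1 q.2)]
  refine Finset.sum_congr rfl fun e _ => ?_
  rw [Finset.sum_mul]
  refine Finset.sum_congr rfl fun q hq => ?_
  rw [symArray, (Finset.mem_filter.1 hq).2]

/-! ### Expectations of the exponential sums, via independence. -/

section Moments

variable {α : Type*} [MeasurableSpace α] {n : ℕ} (μ : UpperIndex n → Measure α)
  [∀ e, IsProbabilityMeasure (μ e)] {b : α → ℝ} {L : ℝ}

lemma bddMeas_of_zero_or_one (hbm : Measurable b) (hb : ∀ a, b a = 0 ∨ b a = 1) : BddMeas b :=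
  ⟨hbm, 1, fun a => by rcases hb a with h | h <;> simp [h]⟩

/-- `exp c - 1 ≤ c exp c`, and for `c ≤ L / 4` the factor `exp c` costs only a quarter of the
exponent of `p = exp (-L)`. -/
lemma integral_exp_mul_le (ν : Measure α) [IsProbabilityMeasure ν] (hbm : Measurable b)
    (hb : ∀ a, b a = 0 ∨ b a = 1) (hp : ∫ a, b a ∂ν = Real.exp (-L)) {c : ℝ} (hc : 0 ≤ c)
    (hcL : c ≤ L / 4) :
    ∫ a, Real.exp (c * b a) ∂ν ≤ Real.exp (Real.exp (-(3 / 4 * L)) * c) := by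
  have h1 : ∀ a, Real.exp (c * b a) = 1 + (Real.exp c - 1) * b a := fun a => by
    rcases hb a with h | h <;> simp [h]
  simp_rw [h1]
  rw [integral_add (integrable_const _) (((bddMeas_of_zero_or_one hbm hb).const_mul _).integrable ν),
    integral_const_mul, hp]
  simp only [integral_const, probReal_univ, smul_eq_mul, one_mul]
  have h2 : Real.exp c - 1 ≤ c * Real.exp c := by
    have := Real.add_one_le_exp (-c)
    have h3 : Real.exp c * Real.exp (-c) = 1 := by rw [← Real.exp_add]; simp
    nlinarith [Real.exp_pos c]
  have h3 : Real.exp c * Real.exp (-L) ≤ Real.exp (-(3 / 4 * L)) := by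
    rw [← Real.exp_add]
    exact Real.exp_le_exp.2 (by linarith)
  have h4 : (Real.exp c - 1) * Real.exp (-L) ≤ Real.exp (-(3 / 4 * L)) * c := by
    calc (Real.exp c - 1) * Real.exp (-L) ≤ c * Real.exp c * Real.exp (-L) := by gcongr
      _ = c * (Real.exp c * Real.exp (-L)) := by ring
      _ ≤ c * Real.exp (-(3 / 4 * L)) := by gcongr
      _ = _ := by ring
  linarith [Real.add_one_le_exp (Real.exp (-(3 / 4 * L)) * c)]

/-- An entry above the diagonal occurs twice in the double sum, so coefficients up to `L / 8` stay
within the range `L / 4` of the one-variable estimate. -/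
lemma integral_exp_symArray_le (hbm : Measurable b)
    (hb : ∀ a, b a = 0 ∨ b a = 1) (hp : ∀ e, ∫ a, b a ∂(μ e) = Real.exp (-L))
    {c : Fin n → Fin n → ℝ} (hc : ∀ i j, 0 ≤ c i j) (hcL : ∀ i j, c i j ≤ L / 8) :
    ∫ x, Real.exp (∑ i, ∑ j, c i j * symArray (fun e => b (x e)) i j) ∂(Measure.pi μ) ≤
      Real.exp (Real.exp (-(3 / 4 * L)) * ∑ i, ∑ j, c i j) := by
  set h : UpperIndex n → ℝ := fun e => ∑ q : Fin n × Fin n with edge q.1 q.2 = e, c q.1 q.2 with hh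
  have h0 : ∀ e, 0 ≤ h e := fun e => Finset.sum_nonneg fun q _ => hc _ _
  have hL : ∀ e, h e ≤ L / 4 := fun e => by
    by_cases hne : (Finset.univ.filter fun q : Fin n × Fin n => edge q.1 q.2 = e).Nonempty
    · obtain ⟨q, -⟩ := hne
      have hLn : 0 ≤ L / 8 := (hc q.1 q.2).trans (hcL q.1 q.2)
      calc h e ≤ (Finset.univ.filter fun q : Fin n × Fin n => edge q.1 q.2 = e).card • (L / 8) :=
            Finset.sum_le_card_nsmul _ _ _ fun q _ => hcL _ _
        _ ≤ 2 • (L / 8) := nsmul_le_nsmul_left hLn (card_edge_fiber_le e)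
        _ = L / 4 := by rw [nsmul_eq_mul]; push_cast; ring
    · have hmem : e.1 ∈ (Finset.univ.filter fun q : Fin n × Fin n => edge q.1 q.2 = e) := by
        simp only [Finset.mem_filter, Finset.mem_univ, true_and]
        exact Subtype.ext (by simp [edge, e.2])
      exact absurd ⟨_, hmem⟩ hne
  have hsum : ∑ e, h e = ∑ i, ∑ j, c i j := by
    have := sum_mul_symArray c (fun _ => 1)
    simpa [symArray] using this.symm
  simp_rw [sum_mul_symArray, Real.exp_sum]
  rw [integral_fintype_prod_eq_prod (fun e a => Real.exp (h e * b a)), ← hsum, Finset.mul_sum,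
    Real.exp_sum]
  exact Finset.prod_le_prod (fun e _ => integral_nonneg fun a => (Real.exp_pos _).le)
    fun e _ => integral_exp_mul_le (μ e) hbm hb (hp e) (h0 e) (hL e)

lemma bddMeas_exp_symArray (hbm : Measurable b) (hb : ∀ a, b a = 0 ∨ b a = 1)
    (c : Fin n → Fin n → ℝ) : BddMeas (fun x : UpperIndex n → α =>
      Real.exp (∑ i, ∑ j, c i j * symArray (fun e => b (x e)) i j)) :=
  (BddMeas.sum _ fun i _ => BddMeas.sum _ fun j _ => ((bddMeas_of_zero_or_one hbm hb).comp
    (measurable_pi_apply (edge i j))).const_mul (c i j)).exp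

lemma theta_mul_block_eq (θ : ℝ) (A B : Finset (Fin n)) (ξ : Fin n → Fin n → ℝ) :
    θ * ∑ i ∈ A, ∑ j ∈ B, ξ i j =
      ∑ i, ∑ j, (if i ∈ A ∧ j ∈ B then θ else 0) * ξ i j := by
  classical
  rw [Finset.mul_sum, ← Finset.sum_subset (Finset.subset_univ A) fun i _ hi => by simp [hi]]
  refine Finset.sum_congr rfl fun i hi => ?_
  rw [Finset.mul_sum, ← Finset.sum_subset (Finset.subset_univ B) fun j _ hj => by simp [hj]]
  exact Finset.sum_congr rfl fun j hj => by simp [hi, hj]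

lemma bddMeas_blockSum (hbm : Measurable b) (hb : ∀ a, b a = 0 ∨ b a = 1) (m β y x θ : ℝ) :
    BddMeas (fun ω : UpperIndex n → α => blockSum m β y x θ (symArray fun e => b (ω e))) := by
  unfold blockSum
  simp_rw [theta_mul_block_eq]
  exact BddMeas.sum _ fun A _ => BddMeas.sum _ fun B _ =>
    (bddMeas_exp_symArray hbm hb _).const_mul _

lemma bddMeas_levelSum (hbm : Measurable b) (hb : ∀ a, b a = 0 ∨ b a = 1) (N : ℕ)
    (η κ x θ : ℝ) :
    BddMeas (fun ω : UpperIndex n → α => levelSum N η κ x θ (symArray fun e => b (ω e))) := by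
  unfold levelSum
  exact BddMeas.sum _ fun a _ => (bddMeas_exp_symArray hbm hb _).const_mul _

lemma sum_finset_pow_card_le {y : ℝ} (hy : 0 ≤ y) :
    ∑ A : Finset (Fin n), y ^ A.card ≤ Real.exp (n * y) := by
  have h := Fintype.sum_pow_mul_eq_add_pow (Fin n) y 1
  simp only [one_pow, mul_one, Fintype.card_fin] at h
  rw [h, Real.exp_nat_mul]
  exact pow_le_pow_left₀ (by linarith) (Real.add_one_le_exp y) n

/-- The weights sum to at most `(1 + y) ^ n (1 + x) ^ n`, and every pair of sets has at most `4 m β`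
entries. -/
lemma integral_blockSum_le (hbm : Measurable b)
    (hb : ∀ a, b a = 0 ∨ b a = 1) (hp : ∀ e, ∫ a, b a ∂(μ e) = Real.exp (-L)) {m β y x : ℝ}
    (hL : 0 ≤ L) (hy : 0 ≤ y) (hx : 0 ≤ x) :
    ∫ ω, blockSum m β y x (L / 8) (symArray fun e => b (ω e)) ∂(Measure.pi μ) ≤
      Real.exp (n * y + n * x + Real.exp (-(3 / 4 * L)) * (L / 8 * (4 * m * β))) := by
  classical
  unfold blockSum
  simp_rw [theta_mul_block_eq]
  have hI := fun A B : Finset (Fin n) => ((bddMeas_exp_symArray (n := n) hbm hb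
    (fun i j => if i ∈ A ∧ j ∈ B then L / 8 else 0)).const_mul
      (y ^ A.card * x ^ B.card)).integrable (Measure.pi μ)
  rw [integral_finsetSum _ fun A _ => integrable_finsetSum _ fun B _ => hI A B]
  simp_rw [integral_finsetSum _ fun B _ => hI _ B, integral_const_mul]
  set K := Real.exp (Real.exp (-(3 / 4 * L)) * (L / 8 * (4 * m * β))) with hK
  have hterm : ∀ A ∈ Finset.univ.filter (fun A : Finset (Fin n) => (A.card : ℝ) ≤ 2 * m),
      ∀ B ∈ Finset.univ.filter (fun B : Finset (Fin n) => (B.card : ℝ) ≤ 2 * β),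
      y ^ A.card * x ^ B.card * ∫ ω, Real.exp (∑ i, ∑ j, (if i ∈ A ∧ j ∈ B then L / 8 else 0) *
        symArray (fun e => b (ω e)) i j) ∂(Measure.pi μ) ≤ y ^ A.card * x ^ B.card * K := by
    intro A hA B hB
    refine mul_le_mul_of_nonneg_left ?_ (by positivity)
    refine (integral_exp_symArray_le μ hbm hb hp (fun i j => by split_ifs <;> linarith)
      (fun i j => by split_ifs <;> linarith)).trans ?_
    refine Real.exp_le_exp.2 (mul_le_mul_of_nonneg_left ?_ (Real.exp_pos _).le)
    have h1 := theta_mul_block_eq (L / 8) A B (fun _ _ => 1)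
    simp only [mul_one] at h1
    rw [← h1]
    refine mul_le_mul_of_nonneg_left ?_ (by linarith)
    simp only [Finset.sum_const, nsmul_eq_mul, mul_one]
    have h2 := (Finset.mem_filter.1 hA).2
    have h3 := (Finset.mem_filter.1 hB).2
    calc (A.card : ℝ) * B.card ≤ 2 * m * (2 * β) :=
          mul_le_mul h2 h3 (Nat.cast_nonneg _) ((Nat.cast_nonneg _).trans h2)
      _ = 4 * m * β := by ring
  refine (Finset.sum_le_sum fun A hA => Finset.sum_le_sum fun B hB => hterm A hA B hB).trans ?_
  have hK0 : 0 < K := Real.exp_pos _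
  calc _ ≤ ∑ A : Finset (Fin n), ∑ B : Finset (Fin n), y ^ A.card * x ^ B.card * K := by
        refine (Finset.sum_le_sum fun A _ => Finset.sum_le_sum_of_subset_of_nonneg
          (Finset.filter_subset _ _) fun B _ _ => by positivity).trans ?_
        exact Finset.sum_le_sum_of_subset_of_nonneg (Finset.filter_subset _ _)
          fun A _ _ => Finset.sum_nonneg fun B _ => by positivity
    _ = (∑ A : Finset (Fin n), y ^ A.card) * (∑ B : Finset (Fin n), x ^ B.card) * K := by
        rw [Finset.sum_mul_sum, Finset.sum_mul]
        simp_rw [Finset.sum_mul]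
    _ ≤ Real.exp (n * y) * Real.exp (n * x) * K := by
        gcongr
        · exact sum_finset_pow_card_le hy
        · exact sum_finset_pow_card_le hx
    _ = _ := by rw [hK, ← Real.exp_add, ← Real.exp_add]

/-- The sum factors over coordinates into the `n`-th power of a geometric sum, at most `1 + 2 x`. -/
lemma sum_pow_sum_le {N : ℕ} {x : ℝ} (hx : 0 ≤ x) (hx2 : x ≤ 1 / 2) :
    ∑ a : Fin n → Fin N, x ^ (∑ i, (a i : ℕ)) ≤ Real.exp (2 * x * n) := by
  have h1 : ∑ a : Fin n → Fin N, x ^ (∑ i, (a i : ℕ)) = (∑ k : Fin N, x ^ (k : ℕ)) ^ n := by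
    simp_rw [← Finset.prod_pow_eq_pow_sum]
    rw [← Fintype.piFinset_univ, Finset.sum_prod_piFinset Finset.univ
      (fun (_ : Fin n) (k : Fin N) => x ^ (k : ℕ))]
    simp
  have h2 : ∑ k : Fin N, x ^ (k : ℕ) ≤ Real.exp (2 * x) := by
    rw [Fin.sum_univ_eq_sum_range (fun k => x ^ k) N]
    have h3 : (∑ k ∈ Finset.range N, x ^ k) * (1 - x) ≤ 1 := by
      have h4 := geom_sum_mul x N
      have h5 : 0 ≤ x ^ N := pow_nonneg hx N
      linarith
    have h6 := Real.add_one_le_exp (2 * x)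
    have h7 : ∑ k ∈ Finset.range N, x ^ k ≤ 1 / (1 - x) := by
      rw [le_div_iff₀ (by linarith)]
      exact h3
    have h8 : 1 / (1 - x) ≤ 2 * x + 1 := by
      rw [div_le_iff₀ (by linarith)]
      nlinarith
    linarith
  rw [h1, show 2 * x * (n : ℝ) = n * (2 * x) by ring, Real.exp_nat_mul]
  exact pow_le_pow_left₀ (Finset.sum_nonneg fun k _ => by positivity) h2 n

lemma truncWeight_le {θ κ : ℝ} (hθ : 0 ≤ θ) (hκ : 0 < κ) {u : Fin n → ℝ} (hu : ∀ i, 0 ≤ u i)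
    (i j : Fin n) : truncWeight θ κ u i j ≤ θ := by
  unfold truncWeight
  split_ifs with h
  · have h1 : u i * u j / κ ≤ 1 := (div_le_one hκ).2 h
    have h2 : 0 ≤ u i * u j / κ := div_nonneg (mul_nonneg (hu i) (hu j)) hκ.le
    have h3 : (u i * u j / κ) ^ 2 ≤ 1 := pow_le_one₀ h2 h1
    nlinarith
  · exact hθ

lemma sum_truncWeight_le {θ κ : ℝ} (hθ : 0 ≤ θ) {u : Fin n → ℝ} (hu : ∑ i, u i ^ 2 ≤ 4) :
    ∑ i, ∑ j, truncWeight θ κ u i j ≤ θ * (16 / κ ^ 2) := by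
  calc ∑ i, ∑ j, truncWeight θ κ u i j ≤ ∑ i, ∑ j, u i ^ 2 * u j ^ 2 * (θ / κ ^ 2) := by
        refine Finset.sum_le_sum fun i _ => Finset.sum_le_sum fun j _ => ?_
        unfold truncWeight
        split_ifs
        · apply le_of_eq; ring
        · positivity
    _ = (∑ i, u i ^ 2) * (∑ j, u j ^ 2) * (θ / κ ^ 2) := by
        rw [Finset.sum_mul_sum, Finset.sum_mul]
        simp_rw [Finset.sum_mul]
    _ ≤ 4 * 4 * (θ / κ ^ 2) := by gcongr
    _ = _ := by ring

lemma integral_levelSum_le (hbm : Measurable b)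
    (hb : ∀ a, b a = 0 ∨ b a = 1) (hp : ∀ e, ∫ a, b a ∂(μ e) = Real.exp (-L)) {N : ℕ}
    {η κ x : ℝ} (hL : 0 ≤ L) (hη : 0 ≤ η) (hκ : 0 < κ) (hx : 0 ≤ x) (hx2 : x ≤ 1 / 2) :
    ∫ ω, levelSum N η κ x (L / 8) (symArray fun e => b (ω e)) ∂(Measure.pi μ) ≤
      Real.exp (2 * x * n + Real.exp (-(3 / 4 * L)) * (L / 8 * (16 / κ ^ 2))) := by
  unfold levelSum
  have hI := fun a : Fin n → Fin N => ((bddMeas_exp_symArray (n := n) hbm hb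
    (truncWeight (L / 8) κ (dyadicVec η a))).const_mul
      (x ^ (∑ i, (a i : ℕ)))).integrable (Measure.pi μ)
  rw [integral_finsetSum _ fun a _ => hI a]
  simp_rw [integral_const_mul]
  set K := Real.exp (Real.exp (-(3 / 4 * L)) * (L / 8 * (16 / κ ^ 2))) with hK
  have hK0 : 0 < K := Real.exp_pos _
  have hθ : 0 ≤ L / 8 := by linarith
  calc _ ≤ ∑ a : Fin n → Fin N with ∑ i, dyadicVec η a i ^ 2 ≤ 4, x ^ (∑ i, (a i : ℕ)) * K := by
        refine Finset.sum_le_sum fun a ha => mul_le_mul_of_nonneg_left ?_ (by positivity)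
        refine (integral_exp_symArray_le μ hbm hb hp (truncWeight_nonneg hθ _ _)
          (truncWeight_le hθ hκ (dyadicVec_nonneg hη a))).trans ?_
        exact Real.exp_le_exp.2 (mul_le_mul_of_nonneg_left
          (sum_truncWeight_le hθ (Finset.mem_filter.1 ha).2) (Real.exp_pos _).le)
    _ ≤ ∑ a : Fin n → Fin N, x ^ (∑ i, (a i : ℕ)) * K :=
        Finset.sum_le_sum_of_subset_of_nonneg (Finset.filter_subset _ _)
          fun a _ _ => by positivity
    _ = (∑ a : Fin n → Fin N, x ^ (∑ i, (a i : ℕ))) * K := by rw [Finset.sum_mul]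
    _ ≤ Real.exp (2 * x * n) * K := by
        gcongr
        exact sum_pow_sum_le hx hx2
    _ = _ := by rw [hK, ← Real.exp_add]

end Moments

/-- A weighted combination of logarithms has controlled exponential moment. -/
lemma integral_exp_sum_log_le {Ω ι : Type*} [MeasurableSpace Ω] (P : Measure Ω)
    [IsProbabilityMeasure P] (s : Finset ι) {S : ι → Ω → ℝ} {c d : ι → ℝ}
    (hS : ∀ i ∈ s, BddMeas (S i)) (hS1 : ∀ i ∈ s, ∀ ω, 1 ≤ S i ω)
    (hd : ∀ i ∈ s, ∫ ω, S i ω ∂P ≤ Real.exp (d i)) (hc : ∀ i ∈ s, 0 ≤ c i)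
    (hcs : ∑ i ∈ s, c i ≤ 1) :
    ∫ ω, Real.exp (∑ i ∈ s, c i * Real.log (S i ω)) ∂P ≤ Real.exp (∑ i ∈ s, c i * d i) := by
  -- Convexity of `exp`, the missing mass `1 - ∑ c i` being placed at `0`. After the shift by `d i`
  -- each term on the right has mean at most `c i`.
  have hpt : ∀ ω, Real.exp (∑ i ∈ s, c i * (Real.log (S i ω) - d i)) ≤
      (1 - ∑ i ∈ s, c i) + ∑ i ∈ s, c i * (Real.exp (-d i) * S i ω) := fun ω => by
    have h := convexOn_exp.map_add_sum_le (t := s) (w := c) (v := 1 - ∑ i ∈ s, c i)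
      (p := fun i => Real.log (S i ω) - d i) (q := 0) hc (by ring) (fun _ _ => Set.mem_univ _)
      (by linarith) (Set.mem_univ _)
    simp only [smul_eq_mul, mul_zero, zero_add, Real.exp_zero, mul_one] at h
    refine h.trans_eq ?_
    congr 1
    refine Finset.sum_congr rfl fun i hi => ?_
    rw [sub_eq_add_neg, Real.exp_add, Real.exp_log (by linarith [hS1 i hi ω]), mul_comm (S i ω)]
  have hlog : BddMeas (fun ω => ∑ i ∈ s, c i * (Real.log (S i ω) - d i)) :=
    BddMeas.sum _ fun i hi => (((hS i hi).log_of_pos one_pos (hS1 i hi)).sub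
      (BddMeas.const (d i))).const_mul (c i)
  have hR : BddMeas (fun ω => ∑ i ∈ s, c i * (Real.exp (-d i) * S i ω)) :=
    BddMeas.sum _ fun i hi => ((hS i hi).const_mul _).const_mul _
  have h1 := integral_mono (hlog.exp.integrable P)
    (((BddMeas.const (1 - ∑ i ∈ s, c i)).add hR).integrable P) hpt
  rw [integral_add (integrable_const _) (hR.integrable P), integral_finsetSum _
    fun i hi => (((hS i hi).const_mul _).const_mul _).integrable P] at h1
  simp only [integral_const_mul, integral_const, probReal_univ, smul_eq_mul, one_mul] at h1
  have h2 : ∑ i ∈ s, c i * (Real.exp (-d i) * ∫ ω, S i ω ∂P) ≤ ∑ i ∈ s, c i := by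
    refine Finset.sum_le_sum fun i hi => ?_
    have : Real.exp (-d i) * ∫ ω, S i ω ∂P ≤ 1 := by
      calc Real.exp (-d i) * ∫ ω, S i ω ∂P ≤ Real.exp (-d i) * Real.exp (d i) := by
            gcongr; exact hd i hi
        _ = 1 := by rw [← Real.exp_add]; simp
    nlinarith [hc i hi]
  have h3 : ∀ ω, Real.exp (∑ i ∈ s, c i * Real.log (S i ω)) = Real.exp (∑ i ∈ s, c i * d i) *
      Real.exp (∑ i ∈ s, c i * (Real.log (S i ω) - d i)) := fun ω => by
    rw [← Real.exp_add, ← Finset.sum_add_distrib]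
    congr 1
    exact Finset.sum_congr rfl fun i _ => by ring
  simp_rw [h3]
  rw [integral_const_mul]
  nlinarith [Real.exp_pos (∑ i ∈ s, c i * d i)]

/-- The range of parameters: sparsity `exp (-L)`, delocalisation `ε`, and truncation level `η`. -/
structure Regime (n : ℕ) (L ε η : ℝ) : Prop where
  n_pos : 1 ≤ n
  L_large : 48 ≤ L
  ε_pos : 0 < ε
  ε_le : ε ≤ 1
  inv_sq_le : 1 / ε ^ 2 ≤ L
  η_pos : 0 < η
  η_le : η ≤ 1
  mean_le : n * Real.exp (-(2 * L)) ≤ 1 / η ^ 2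
  log_le : 4 * (1 / ε ^ 2) * Real.log n ≤ 1 / η ^ 2 * L

/-- Number of dyadic levels above `η`. -/
noncomputable def levels (η : ℝ) : ℕ := ⌈1 / η⌉₊ + 2

lemma lt_levels (η : ℝ) : 1 / η + 1 < levels η := by
  have := Nat.le_ceil (1 / η)
  simp only [levels]
  push_cast
  linarith

/-- `blockSum` with the weights used for a matrix of sparsity `exp (-L)`. -/
noncomputable def sparseBlockSum {n : ℕ} (L ε η : ℝ) (ξ : Fin n → Fin n → ℝ) : ℝ :=
  blockSum (1 / ε ^ 2) (1 / η ^ 2) (1 / n) (Real.exp (-(2 * L))) (L / 8) ξ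

/-- `levelSum` at the level `2 ^ q` with the weights used for a matrix of sparsity `exp (-L)`. -/
noncomputable def sparseLevelSum {n : ℕ} (L ε η : ℝ) (q : ℕ) (ξ : Fin n → Fin n → ℝ) : ℝ :=
  levelSum (levels η) (2 ^ q * η) (8 * (2 ^ q * (ε * η))) (Real.exp (-(2 * L)) / 4 ^ q) (L / 8) ξ

/-- Upper bound for the light part of all delocalised quadratic forms with squared weights. -/
noncomputable def lightBound {n : ℕ} (L ε η : ℝ) (ξ : Fin n → Fin n → ℝ) : ℝ :=
  (ε * η) ^ 2 * (16 * Real.log (sparseBlockSum L ε η ξ) +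
    512 * Real.log (sparseLevelSum L ε η 0 ξ)) / L + 1096 * ε ^ 2

/-- Upper bound for the heavy part of all delocalised quadratic forms. -/
noncomputable def heavyBound {n : ℕ} (L ε η : ℝ) (Q : ℕ) (ξ : Fin n → Fin n → ℝ) : ℝ :=
  ∑ q ∈ Finset.range Q, 1024 * 2 ^ q * (ε * η) / L * Real.log (sparseLevelSum L ε η q ξ) +
    8193 * (ε / η)

lemma exp_mul_sq_le {L : ℝ} (hL : 48 ≤ L) : Real.exp (-(3 / 4 * L)) * (L * L) ≤ 1 := by
  have h1 := Real.pow_div_factorial_le_exp (3 / 4 * L) (by linarith) 3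
  have h2 : L * L ≤ Real.exp (3 / 4 * L) := by
    refine le_trans ?_ h1
    simp only [Nat.factorial]
    norm_num
    nlinarith [sq_nonneg L]
  calc Real.exp (-(3 / 4 * L)) * (L * L) ≤ Real.exp (-(3 / 4 * L)) * Real.exp (3 / 4 * L) := by
        gcongr
    _ = 1 := by rw [← Real.exp_add]; simp

/-! ### Light and heavy bounds in the parameter regime, and their exponential moments. -/

namespace Regime

variable {n : ℕ} {L ε η : ℝ}

lemma weight_pos (q : ℕ) : 0 < Real.exp (-(2 * L)) / 4 ^ q := by positivity

lemma weight_le_half (h : Regime n L ε η) (q : ℕ) : Real.exp (-(2 * L)) / 4 ^ q ≤ 1 / 2 := by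
  have h1 : Real.exp (-(2 * L)) ≤ 1 / 2 := by
    have h2 := Real.add_one_le_exp (2 * L)
    rw [Real.exp_neg, inv_eq_one_div]
    exact one_div_le_one_div_of_le (by norm_num) (by linarith [h.L_large])
  exact (div_le_self (Real.exp_pos _).le (one_le_pow₀ (by norm_num))).trans h1

lemma one_le_sparseBlockSum (ξ : Fin n → Fin n → ℝ) :
    1 ≤ sparseBlockSum L ε η ξ :=
  one_le_blockSum (by positivity) (by positivity) (by positivity) (by positivity) ξ

lemma one_le_sparseLevelSum (q : ℕ) (ξ : Fin n → Fin n → ℝ) :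
    1 ≤ sparseLevelSum L ε η q ξ :=
  one_le_levelSum (by simp [levels]) (weight_pos _).le ξ

lemma light_sum_le (h : Regime n L ε η) {ξ : Fin n → Fin n → ℝ} (hξ : ∀ i j, 0 ≤ ξ i j)
    (hsymm : ∀ i j, ξ i j = ξ j i) {v : Fin n → ℝ} (hv0 : ∀ i, 0 ≤ v i) (hvε : ∀ i, v i ≤ ε)
    (hv : ∑ i, v i ^ 2 ≤ 1) :
    ∑ i, ∑ j, (if v i * v j ≤ ε * η then (v i * v j) ^ 2 * ξ i j else 0) ≤
      lightBound L ε η ξ := by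
  have hn : (1 : ℝ) ≤ n := by exact_mod_cast h.n_pos
  have hL : 0 < L := by linarith [h.L_large]
  have hε := h.ε_pos
  have hη := h.η_pos
  have hx1 := (h.weight_le_half 0).trans (by norm_num : (1 / 2 : ℝ) ≤ 1)
  rw [pow_zero, div_one] at hx1
  have h1 := SparseWigner.light_sum_le hε h.ε_le hη h.η_le (y := 1 / n) (by positivity)
    (by rw [div_le_one (by linarith)]; exact hn) (Real.exp_pos (-(2 * L))) hx1
    (by positivity : 0 < L / 8) (lt_levels η) hξ hsymm hv0 hvε hv
  refine h1.trans ?_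
  unfold lightBound sparseBlockSum sparseLevelSum
  simp only [pow_zero, one_mul, div_one]
  rw [one_div_one_div, one_div (Real.exp _), ← Real.exp_neg, Real.log_exp, neg_neg]
  set l₁ := Real.log (blockSum (1 / ε ^ 2) (1 / η ^ 2) (1 / n) (Real.exp (-(2 * L))) (L / 8) ξ)
  set l₂ := Real.log (levelSum (levels η) η (8 * (ε * η)) (Real.exp (-(2 * L))) (L / 8) ξ)
  have h2 := h.log_le
  -- The entropy terms add up to `8 ε² (1 + 8 + 128) = 1096 ε²`; `log_le` is what makes the cost
  -- `log n` of the first set comparable to `L / η²`.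
  calc (ε * η) ^ 2 / (L / 8) * (2 * (l₁ + 2 * (1 / ε ^ 2) * Real.log n +
        2 * (1 / η ^ 2) * (2 * L)) + 64 * (l₂ + 1 / η ^ 2 * (2 * L)))
      ≤ (ε * η) ^ 2 / (L / 8) * (2 * (l₁ + 1 / η ^ 2 * L / 2 +
        2 * (1 / η ^ 2) * (2 * L)) + 64 * (l₂ + 1 / η ^ 2 * (2 * L))) := by
        refine mul_le_mul_of_nonneg_left ?_ (by positivity)
        linarith
    _ = _ := by field_simp; ring

lemma heavy_sum_le (h : Regime n L ε η) {Q : ℕ} (hQ : 1 / ε ^ 2 ≤ 2 ^ Q)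
    (hQ' : (2 : ℝ) ^ Q ≤ 2 / ε ^ 2) {ξ : Fin n → Fin n → ℝ} (hξ : ∀ i j, 0 ≤ ξ i j)
    (hξ1 : ∀ i j, ξ i j ≤ 1) {v : Fin n → ℝ} (hv0 : ∀ i, 0 ≤ v i) (hvε : ∀ i, v i ≤ ε)
    (hv : ∑ i, v i ^ 2 ≤ 1) :
    ∑ i, ∑ j, (if ε * η < v i * v j then v i * v j * ξ i j else 0) ≤
      heavyBound L ε η Q ξ := by
  have hL : 0 < L := by linarith [h.L_large]
  have hε := h.ε_pos
  have hη := h.η_pos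
  have h1 := SparseWigner.heavy_sum_le hε hη (x := fun q => Real.exp (-(2 * L)) / 4 ^ q)
    (fun q => weight_pos q) (fun q => (h.weight_le_half q).trans (by norm_num))
    (by positivity : 0 < L / 8) (lt_levels η) hξ hξ1 hv0 hvε hv Q
  refine h1.trans ?_
  unfold heavyBound
  have hlast : 1 / (2 ^ Q * (ε * η)) ≤ ε / η := by
    rw [div_le_div_iff₀ (by positivity) hη]
    rw [div_le_iff₀ (by positivity)] at hQ
    nlinarith
  have hterm : ∀ q ∈ Finset.range Q, 128 * 2 ^ q * (ε * η) / (L / 8) *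
      (Real.log (levelSum (levels η) (2 ^ q * η) (8 * (2 ^ q * (ε * η)))
        (Real.exp (-(2 * L)) / 4 ^ q) (L / 8) ξ) +
        1 / (2 ^ q * η) ^ 2 * Real.log (1 / (Real.exp (-(2 * L)) / 4 ^ q))) ≤
      1024 * 2 ^ q * (ε * η) / L * Real.log (sparseLevelSum L ε η q ξ) +
        4096 * (ε / η) * (1 / 2) ^ q := by
    intro q hq
    -- Only shells with `2 ^ q ≤ 1 / ε² ≤ L` occur, so the extra weight `4 ^ (-q)` costs at most `2
    -- L` in the logarithm.
    have hq2 : (2 : ℝ) ^ q ≤ L := by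
      have h3 : (2 : ℝ) ^ (q + 1) ≤ 2 ^ Q :=
        pow_le_pow_right₀ (by norm_num) (Finset.mem_range.1 hq)
      rw [pow_succ] at h3
      have h4 : 2 / ε ^ 2 = 2 * (1 / ε ^ 2) := by ring
      linarith [h.inv_sq_le]
    have hlog : Real.log (1 / (Real.exp (-(2 * L)) / 4 ^ q)) ≤ 4 * L := by
      rw [one_div_div, Real.log_div (by positivity) (Real.exp_pos _).ne', Real.log_exp]
      have h5 : Real.log ((4 : ℝ) ^ q) = 2 * Real.log (2 ^ q) := by
        rw [show (4 : ℝ) = 2 ^ 2 by norm_num, ← pow_mul, mul_comm 2 q, pow_mul, Real.log_pow]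
        norm_num
      have h6 := Real.log_le_self (by positivity : (0 : ℝ) ≤ 2 ^ q)
      linarith
    calc _ ≤ 128 * 2 ^ q * (ε * η) / (L / 8) * (Real.log (sparseLevelSum L ε η q ξ) +
          1 / (2 ^ q * η) ^ 2 * (4 * L)) := by
          unfold sparseLevelSum
          gcongr
      _ = _ := by
          rw [one_div_pow]
          field_simp
          ring
  refine (add_le_add (Finset.sum_le_sum hterm) hlast).trans ?_
  rw [Finset.sum_add_distrib, ← Finset.mul_sum]
  have hgeo : ∑ q ∈ Finset.range Q, (1 / 2 : ℝ) ^ q ≤ 2 := sum_geometric_two_le Q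
  have hpos : 0 < ε / η := by positivity
  nlinarith

section Moments

variable {α : Type*} [MeasurableSpace α] (μ : UpperIndex n → Measure α)
  [∀ e, IsProbabilityMeasure (μ e)] {b : α → ℝ}

/-- The three contributions `n · (1 / n)`, `n p²` and the mean number of entries in a block, damped
by `p ^ (3/4)`, are each at most `1 / η²`. -/
lemma integral_sparseBlockSum_le (h : Regime n L ε η) (hbm : Measurable b)
    (hb : ∀ a, b a = 0 ∨ b a = 1) (hp : ∀ e, ∫ a, b a ∂(μ e) = Real.exp (-L)) :
    ∫ ω, sparseBlockSum L ε η (symArray fun e => b (ω e)) ∂(Measure.pi μ) ≤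
      Real.exp (3 * (1 / η ^ 2)) := by
  have hL := h.L_large
  have hε := h.ε_pos
  have hη := h.η_pos
  have hn : (1 : ℝ) ≤ n := by exact_mod_cast h.n_pos
  refine (integral_blockSum_le μ hbm hb hp (by linarith) (by positivity)
    (Real.exp_pos _).le).trans (Real.exp_le_exp.2 ?_)
  have h1 : (n : ℝ) * (1 / n) = 1 := by field_simp
  have h2 : 1 ≤ 1 / η ^ 2 := (one_le_div (by positivity)).2 (pow_le_one₀ hη.le h.η_le)
  have h3 : Real.exp (-(3 / 4 * L)) * (L / 8 * (4 * (1 / ε ^ 2) * (1 / η ^ 2))) ≤ 1 / η ^ 2 := by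
    calc _ ≤ Real.exp (-(3 / 4 * L)) * (L / 8 * (4 * L * (1 / η ^ 2))) := by
          gcongr
          exact h.inv_sq_le
      _ = Real.exp (-(3 / 4 * L)) * (L * L) * (1 / 2 * (1 / η ^ 2)) := by ring
      _ ≤ 1 * (1 / 2 * (1 / η ^ 2)) := by
          gcongr
          exact exp_mul_sq_le hL
      _ ≤ 1 / η ^ 2 := by linarith
  linarith [h.mean_le]

/-- The mass of the weights and the mean term both decay like `4 ^ (-q)`, which beats the factors `2
^ q` in `heavyBound`. -/
lemma integral_sparseLevelSum_le (h : Regime n L ε η) (hbm : Measurable b)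
    (hb : ∀ a, b a = 0 ∨ b a = 1) (hp : ∀ e, ∫ a, b a ∂(μ e) = Real.exp (-L)) (q : ℕ) :
    ∫ ω, sparseLevelSum L ε η q (symArray fun e => b (ω e)) ∂(Measure.pi μ) ≤
      Real.exp (3 * (1 / η ^ 2) / 4 ^ q) := by
  have hL := h.L_large
  have hε := h.ε_pos
  have hη := h.η_pos
  refine (integral_levelSum_le μ hbm hb hp (by linarith) (by positivity) (by positivity)
    (weight_pos _).le (h.weight_le_half q)).trans (Real.exp_le_exp.2 ?_)
  have h2q : ((2 : ℝ) ^ q) ^ 2 = 4 ^ q := by rw [← pow_mul, mul_comm, pow_mul]; norm_num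
  have h3 : Real.exp (-(3 / 4 * L)) * (L / 8 * (16 / (8 * (2 ^ q * (ε * η))) ^ 2)) ≤
      1 / η ^ 2 / 4 ^ q := by
    calc _ = Real.exp (-(3 / 4 * L)) * (L * (1 / ε ^ 2)) * (1 / 32 * (1 / η ^ 2 / 4 ^ q)) := by
          rw [← h2q]; field_simp; norm_num
      _ ≤ Real.exp (-(3 / 4 * L)) * (L * L) * (1 / 32 * (1 / η ^ 2 / 4 ^ q)) := by
          gcongr
          exact h.inv_sq_le
      _ ≤ 1 * (1 / 32 * (1 / η ^ 2 / 4 ^ q)) := by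
          gcongr
          exact exp_mul_sq_le hL
      _ ≤ 1 / η ^ 2 / 4 ^ q := by
          have : 0 < 1 / η ^ 2 / 4 ^ q := by positivity
          linarith
  have h4 : 2 * (Real.exp (-(2 * L)) / 4 ^ q) * n ≤ 2 * (1 / η ^ 2) / 4 ^ q := by
    rw [show 2 * (Real.exp (-(2 * L)) / 4 ^ q) * (n : ℝ) =
      2 * (n * Real.exp (-(2 * L))) / 4 ^ q by ring]
    gcongr
    exact h.mean_le
  calc _ ≤ 2 * (1 / η ^ 2) / 4 ^ q + 1 / η ^ 2 / 4 ^ q := add_le_add h4 h3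
    _ = _ := by ring

lemma bddMeas_lightBound (hbm : Measurable b) (hb : ∀ a, b a = 0 ∨ b a = 1) :
    BddMeas (fun ω : UpperIndex n → α => lightBound L ε η (symArray fun e => b (ω e))) := by
  have h1 := (bddMeas_blockSum (n := n) hbm hb (1 / ε ^ 2) (1 / η ^ 2) (1 / n)
    (Real.exp (-(2 * L))) (L / 8)).log_of_pos one_pos fun _ => one_le_sparseBlockSum _
  have h2 := (bddMeas_levelSum (n := n) hbm hb (levels η) (2 ^ 0 * η) (8 * (2 ^ 0 * (ε * η)))
    (Real.exp (-(2 * L)) / 4 ^ 0) (L / 8)).log_of_pos one_pos fun _ => one_le_sparseLevelSum 0 _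
  unfold lightBound
  simp_rw [mul_div_right_comm]
  exact (((h1.const_mul 16).add (h2.const_mul 512)).const_mul _).add (BddMeas.const _)

lemma bddMeas_heavyBound (hbm : Measurable b) (hb : ∀ a, b a = 0 ∨ b a = 1) (Q : ℕ) :
    BddMeas (fun ω : UpperIndex n → α => heavyBound L ε η Q (symArray fun e => b (ω e))) :=
  (BddMeas.sum _ fun q _ => ((bddMeas_levelSum (n := n) hbm hb (levels η) (2 ^ q * η)
    (8 * (2 ^ q * (ε * η))) (Real.exp (-(2 * L)) / 4 ^ q) (L / 8)).log_of_pos one_pos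
      fun _ => one_le_sparseLevelSum q _).const_mul _).add (BddMeas.const _)

lemma integral_exp_lightBound_le (h : Regime n L ε η) (hbm : Measurable b)
    (hb : ∀ a, b a = 0 ∨ b a = 1) (hp : ∀ e, ∫ a, b a ∂(μ e) = Real.exp (-L)) {r : ℝ}
    (hr : 0 ≤ r) (hr1 : r * (528 * (ε * η) ^ 2 / L) ≤ 1) :
    ∫ ω, Real.exp (r * lightBound L ε η (symArray fun e => b (ω e))) ∂(Measure.pi μ) ≤
      Real.exp (r * (1200 * ε ^ 2)) := by
  have hL := h.L_large
  have hL0 : 0 < L := by linarith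
  have hε := h.ε_pos
  have hη := h.η_pos
  -- The two exponential sums enter with weights `16` and `512`, in total `528`; their means add `3
  -- · 528 / L ≤ 104` to `1096`.
  have key := integral_exp_sum_log_le (Measure.pi μ) (Finset.univ : Finset Bool)
    (S := fun i ω => if i then sparseBlockSum L ε η (symArray fun e => b (ω e)) else
      sparseLevelSum L ε η 0 (symArray fun e => b (ω e)))
    (c := fun i => if i then r * (16 * (ε * η) ^ 2 / L) else r * (512 * (ε * η) ^ 2 / L))
    (d := fun _ => 3 * (1 / η ^ 2)) ?_ ?_ ?_ ?_ ?_
  · simp only [Fintype.sum_bool, if_true, Bool.false_eq_true, if_false] at key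
    have e1 : ∀ ω : UpperIndex n → α, Real.exp (r * lightBound L ε η (symArray fun e => b (ω e))) =
        Real.exp (r * (1096 * ε ^ 2)) *
        Real.exp (r * (16 * (ε * η) ^ 2 / L) *
          Real.log (sparseBlockSum L ε η (symArray fun e => b (ω e))) +
          r * (512 * (ε * η) ^ 2 / L) *
          Real.log (sparseLevelSum L ε η 0 (symArray fun e => b (ω e)))) := fun ω => by
      rw [← Real.exp_add]
      congr 1
      unfold lightBound
      ring
    simp_rw [e1]
    rw [integral_const_mul]
    refine (mul_le_mul_of_nonneg_left key (Real.exp_pos _).le).trans ?_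
    rw [← Real.exp_add]
    refine Real.exp_le_exp.2 ?_
    have e2 : r * (16 * (ε * η) ^ 2 / L) * (3 * (1 / η ^ 2)) +
        r * (512 * (ε * η) ^ 2 / L) * (3 * (1 / η ^ 2)) = r * (1584 / L * ε ^ 2) := by
      field_simp; ring
    rw [e2, ← mul_add]
    refine mul_le_mul_of_nonneg_left ?_ hr
    have h1 : 1584 / L ≤ 104 := by rw [div_le_iff₀ hL0]; linarith
    nlinarith [sq_nonneg ε]
  · rintro (_ | _) -
    · simp only [Bool.false_eq_true, if_false]
      exact bddMeas_levelSum hbm hb _ _ _ _ _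
    · simp only [if_true]
      exact bddMeas_blockSum hbm hb _ _ _ _ _
  · rintro (_ | _) - ω
    · simpa using one_le_sparseLevelSum 0 _
    · simpa using one_le_sparseBlockSum _
  · rintro (_ | _) -
    · simpa using h.integral_sparseLevelSum_le μ hbm hb hp 0
    · simpa using h.integral_sparseBlockSum_le μ hbm hb hp
  · rintro (_ | _) -
    · simp only [Bool.false_eq_true, if_false]; positivity
    · simp only [if_true]; positivity
  · simp only [Fintype.sum_bool, if_true, Bool.false_eq_true, if_false]
    refine le_trans (le_of_eq ?_) hr1
    ring

lemma integral_exp_heavyBound_le (h : Regime n L ε η) (hbm : Measurable b)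
    (hb : ∀ a, b a = 0 ∨ b a = 1) (hp : ∀ e, ∫ a, b a ∂(μ e) = Real.exp (-L)) {Q : ℕ}
    (hQ : (2 : ℝ) ^ Q ≤ 2 / ε ^ 2) {r : ℝ} (hr : 0 ≤ r) (hr1 : r * (2048 * η / (ε * L)) ≤ 1) :
    ∫ ω, Real.exp (r * heavyBound L ε η Q (symArray fun e => b (ω e))) ∂(Measure.pi μ) ≤
      Real.exp (r * (8400 * (ε / η))) := by
  have hL := h.L_large
  have hL0 : 0 < L := by linarith
  have hε := h.ε_pos
  have hη := h.η_pos
  have key := integral_exp_sum_log_le (Measure.pi μ) (Finset.range Q)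
    (S := fun q ω => sparseLevelSum L ε η q (symArray fun e => b (ω e)))
    (c := fun q => r * (1024 * 2 ^ q * (ε * η) / L)) (d := fun q => 3 * (1 / η ^ 2) / 4 ^ q)
    (fun q _ => bddMeas_levelSum hbm hb _ _ _ _ _) (fun q _ ω => one_le_sparseLevelSum q _)
    (fun q _ => h.integral_sparseLevelSum_le μ hbm hb hp q) (fun q _ => by positivity) ?_
  · have e1 : ∀ ω : UpperIndex n → α,
        Real.exp (r * heavyBound L ε η Q (symArray fun e => b (ω e))) =
        Real.exp (r * (8193 * (ε / η))) *
        Real.exp (∑ q ∈ Finset.range Q, r * (1024 * 2 ^ q * (ε * η) / L) *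
          Real.log (sparseLevelSum L ε η q (symArray fun e => b (ω e)))) := fun ω => by
      rw [← Real.exp_add]
      congr 1
      unfold heavyBound
      rw [mul_add, Finset.mul_sum, add_comm]
      simp_rw [mul_assoc]
    simp_rw [e1]
    rw [integral_const_mul]
    refine (mul_le_mul_of_nonneg_left key (Real.exp_pos _).le).trans ?_
    rw [← Real.exp_add]
    refine Real.exp_le_exp.2 ?_
    have e2 : ∀ q : ℕ, r * (1024 * 2 ^ q * (ε * η) / L) * (3 * (1 / η ^ 2) / 4 ^ q) =
        r * (3072 / L * (ε / η)) * (1 / 2) ^ q := fun q => by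
      rw [show (4 : ℝ) = 2 * 2 by norm_num, mul_pow, one_div_pow]
      field_simp
      ring
    simp_rw [e2]
    rw [← Finset.mul_sum]
    have hgeo : ∑ q ∈ Finset.range Q, (1 / 2 : ℝ) ^ q ≤ 2 := sum_geometric_two_le Q
    have h1 : 3072 / L ≤ 64 := by rw [div_le_iff₀ hL0]; linarith
    calc _ ≤ r * (8193 * (ε / η)) + r * (64 * (ε / η)) * 2 := by gcongr
      _ ≤ _ := by
        have : 0 ≤ r * (ε / η) := by positivity
        linarith
  · rw [← Finset.mul_sum]
    refine le_trans (mul_le_mul_of_nonneg_left ?_ hr) hr1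
    have e3 : ∑ q ∈ Finset.range Q, 1024 * 2 ^ q * (ε * η) / L =
        1024 * (ε * η) / L * ∑ q ∈ Finset.range Q, (2 : ℝ) ^ q := by
      rw [Finset.mul_sum]
      exact Finset.sum_congr rfl fun q _ => by ring
    -- The weights grow with `q`, so it is the upper bound on `2 ^ Q` that keeps their total at most
    -- `1`.
    have h2 : ∑ q ∈ Finset.range Q, (2 : ℝ) ^ q ≤ 2 / ε ^ 2 := by
      have := geom_sum_mul (2 : ℝ) Q
      linarith
    rw [e3]
    calc _ ≤ 1024 * (ε * η) / L * (2 / ε ^ 2) := by gcongr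
      _ = _ := by field_simp; norm_num

end Moments

end Regime

/-! ### Suprema of affine functions with flat slopes -/

/-- A family of affine functions on symmetric matrices whose slopes are flat. -/
structure FlatFamily (n k : ℕ) (ε : ℝ) (κ : Type*) where
  /-- constant terms -/
  c : κ → ℝ
  /-- coefficients of the slopes -/
  θ : κ → Fin k → ℝ
  /-- vectors of the slopes -/
  v : κ → Fin k → Fin n → ℝ
  c_le : ∃ C, ∀ K, c K ≤ C
  abs_θ_le : ∀ K l, |θ K l| ≤ 1
  abs_v_le : ∀ K l i, |v K l i| ≤ ε
  sum_sq_le : ∀ K l, ∑ i, v K l i ^ 2 ≤ 1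

namespace FlatFamily

variable {n k : ℕ} {ε : ℝ} {κ : Type*} (D : FlatFamily n k ε κ)

/-- The slopes, truncated at the level `τ`. -/
noncomputable def truncCoef (τ : ℝ) (K : κ) (i j : Fin n) : ℝ :=
  ∑ l, if |D.v K l i| * |D.v K l j| ≤ τ then D.θ K l * (D.v K l i * D.v K l j) else 0

/-- The supremum of the affine functions with truncated slopes. -/
noncomputable def truncSup (τ : ℝ) (z : UpperIndex n → ℝ) : ℝ :=
  ⨆ K, (D.c K + ∑ i, ∑ j, D.truncCoef τ K i j * symArray z i j)

lemma abs_v_le_one (K : κ) (l : Fin k) (i : Fin n) : |D.v K l i| ≤ 1 := by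
  have h1 := (Finset.single_le_sum (f := fun i => D.v K l i ^ 2) (fun i _ => sq_nonneg _)
    (Finset.mem_univ i)).trans (D.sum_sq_le K l)
  exact (sq_le_one_iff_abs_le_one _).1 h1

lemma abs_term_le (K : κ) (l : Fin k) (i j : Fin n) :
    |D.θ K l * (D.v K l i * D.v K l j)| ≤ |D.v K l i| * |D.v K l j| := by
  rw [abs_mul, abs_mul]
  exact mul_le_of_le_one_left (by positivity) (D.abs_θ_le K l)

lemma abs_truncCoef_le (τ : ℝ) (K : κ) (i j : Fin n) : |D.truncCoef τ K i j| ≤ k := by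
  unfold truncCoef
  refine (Finset.abs_sum_le_sum_abs _ _).trans ?_
  calc _ ≤ ∑ _l : Fin k, (1 : ℝ) := Finset.sum_le_sum fun l _ => by
        split_ifs
        · refine (D.abs_term_le K l i j).trans ?_
          exact mul_le_one₀ (D.abs_v_le_one K l i) (abs_nonneg _) (D.abs_v_le_one K l j)
        · simp
    _ = k := by simp

lemma truncCoef_sq_le (τ : ℝ) (K : κ) (i j : Fin n) :
    D.truncCoef τ K i j ^ 2 ≤ k * ∑ l, if |D.v K l i| * |D.v K l j| ≤ τ then
      (|D.v K l i| * |D.v K l j|) ^ 2 else 0 := by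
  unfold truncCoef
  refine sq_sum_le_card_mul_sum_sq.trans ?_
  rw [Finset.card_univ, Fintype.card_fin]
  refine mul_le_mul_of_nonneg_left (Finset.sum_le_sum fun l _ => ?_) (Nat.cast_nonneg k)
  split_ifs
  · rw [← sq_abs]
    exact pow_le_pow_left₀ (abs_nonneg _) (D.abs_term_le K l i j) 2
  · simp

lemma sum_truncCoef_sq_mul_le (τ : ℝ) (K : κ) {ξ : Fin n → Fin n → ℝ} (hξ : ∀ i j, 0 ≤ ξ i j)
    {B : ℝ} (hB : ∀ l, ∑ i, ∑ j, (if |D.v K l i| * |D.v K l j| ≤ τ then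
      (|D.v K l i| * |D.v K l j|) ^ 2 * ξ i j else 0) ≤ B) :
    ∑ i, ∑ j, D.truncCoef τ K i j ^ 2 * ξ i j ≤ k ^ 2 * B := by
  calc ∑ i, ∑ j, D.truncCoef τ K i j ^ 2 * ξ i j
      ≤ ∑ i, ∑ j, (k * ∑ l, if |D.v K l i| * |D.v K l j| ≤ τ then
        (|D.v K l i| * |D.v K l j|) ^ 2 else 0) * ξ i j :=
        Finset.sum_le_sum fun i _ => Finset.sum_le_sum fun j _ =>
          mul_le_mul_of_nonneg_right (D.truncCoef_sq_le τ K i j) (hξ i j)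
    _ = k * ∑ l, ∑ i, ∑ j, (if |D.v K l i| * |D.v K l j| ≤ τ then
        (|D.v K l i| * |D.v K l j|) ^ 2 * ξ i j else 0) := by
        rw [Finset.sum_comm (s := (Finset.univ : Finset (Fin k)))]
        rw [Finset.mul_sum]
        refine Finset.sum_congr rfl fun i _ => ?_
        rw [Finset.sum_comm (s := (Finset.univ : Finset (Fin k))), Finset.mul_sum]
        refine Finset.sum_congr rfl fun j _ => ?_
        rw [mul_assoc, Finset.sum_mul]
        simp_rw [ite_mul, zero_mul]
    _ ≤ k * ∑ _l : Fin k, B := by gcongr with l; exact hB l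
    _ = k ^ 2 * B := by simp; ring

lemma sum_abs_sq_le (K : κ) (l : Fin k) : ∑ i, |D.v K l i| ^ 2 ≤ 1 := by
  simpa using D.sum_sq_le K l

lemma sum_truncCoef_sq_le (τ : ℝ) (K : κ) : ∑ i, ∑ j, D.truncCoef τ K i j ^ 2 ≤ k ^ 2 := by
  have h := D.sum_truncCoef_sq_mul_le τ K (ξ := fun _ _ => 1) (fun _ _ => zero_le_one) (B := 1) ?_
  · simpa using h
  · intro l
    calc _ ≤ ∑ i, ∑ j, |D.v K l i| ^ 2 * |D.v K l j| ^ 2 := by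
          refine Finset.sum_le_sum fun i _ => Finset.sum_le_sum fun j _ => ?_
          split_ifs
          · rw [mul_one, mul_pow]
          · positivity
      _ = (∑ i, |D.v K l i| ^ 2) * ∑ j, |D.v K l j| ^ 2 := by rw [Finset.sum_mul_sum]
      _ ≤ 1 := mul_le_one₀ (D.sum_abs_sq_le K l) (Finset.sum_nonneg fun i _ => by positivity)
          (D.sum_abs_sq_le K l)

lemma abs_sum_truncCoef_mul_le (τ : ℝ) (K : κ) (z : UpperIndex n → ℝ) :
    |∑ i, ∑ j, D.truncCoef τ K i j * symArray z i j| ≤ ∑ i, ∑ j, k * |symArray z i j| := by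
  refine (Finset.abs_sum_le_sum_abs _ _).trans (Finset.sum_le_sum fun i _ => ?_)
  refine (Finset.abs_sum_le_sum_abs _ _).trans (Finset.sum_le_sum fun j _ => ?_)
  rw [abs_mul]
  exact mul_le_mul_of_nonneg_right (D.abs_truncCoef_le τ K i j) (abs_nonneg _)

lemma bddAbove_truncSup (τ : ℝ) (z : UpperIndex n → ℝ) : BddAbove (Set.range fun K =>
    D.c K + ∑ i, ∑ j, D.truncCoef τ K i j * symArray z i j) := by
  obtain ⟨C, hC⟩ := D.c_le
  refine ⟨C + ∑ i, ∑ j, k * |symArray z i j|, ?_⟩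
  rintro _ ⟨K, rfl⟩
  exact add_le_add (hC K) ((le_abs_self _).trans (D.abs_sum_truncCoef_mul_le τ K z))

lemma le_truncSup (τ : ℝ) (z : UpperIndex n → ℝ) (K : κ) :
    D.c K + ∑ i, ∑ j, D.truncCoef τ K i j * symArray z i j ≤ D.truncSup τ z :=
  le_ciSup (D.bddAbove_truncSup τ z) K

lemma symArray_sub (z z' : UpperIndex n → ℝ) (i j : Fin n) :
    symArray (z - z') i j = symArray z i j - symArray z' i j := rfl

/-- A near-maximiser at `z` is an approximate subgradient there. The same `K` serves for every `z'`,
so the increments in all coordinates can be summed against one slope. -/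
lemma exists_truncSup_sub_le [Nonempty κ] (τ : ℝ) (z : UpperIndex n → ℝ) {δ : ℝ} (hδ : 0 < δ) :
    ∃ K, ∀ z', D.truncSup τ z - D.truncSup τ z' ≤
      ∑ i, ∑ j, D.truncCoef τ K i j * symArray (z - z') i j + δ := by
  obtain ⟨K, hK⟩ := exists_lt_of_lt_ciSup (sub_lt_self (D.truncSup τ z) hδ)
  refine ⟨K, fun z' => ?_⟩
  have h1 := D.le_truncSup τ z' K
  simp_rw [symArray_sub, mul_sub, Finset.sum_sub_distrib]
  linarith

lemma continuous_truncSup [Nonempty κ] (τ : ℝ) : Continuous (D.truncSup τ) := by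
  have h : LipschitzWith (Real.toNNReal (n * (n * k))) (D.truncSup τ) := by
    refine LipschitzWith.of_le_add_mul _ fun z z' => ?_
    rw [Real.coe_toNNReal _ (by positivity)]
    refine le_of_forall_pos_le_add fun δ hδ => ?_
    obtain ⟨K, hK⟩ := D.exists_truncSup_sub_le τ z hδ
    have h1 := (le_abs_self _).trans (D.abs_sum_truncCoef_mul_le τ K (z - z'))
    have h2 : ∑ i : Fin n, ∑ j : Fin n, k * |symArray (z - z') i j| ≤
        ∑ _i : Fin n, ∑ _j : Fin n, k * dist z z' := by
      refine Finset.sum_le_sum fun i _ => Finset.sum_le_sum fun j _ => ?_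
      refine mul_le_mul_of_nonneg_left ?_ (Nat.cast_nonneg k)
      have := dist_le_pi_dist z z' (edge i j)
      rwa [Real.dist_eq] at this
    have h3 : ∑ _i : Fin n, ∑ _j : Fin n, (k : ℝ) * dist z z' = n * (n * k) * dist z z' := by
      simp; ring
    linarith [hK z']
  exact h.continuous

lemma abs_truncSup_le [Nonempty κ] (τ : ℝ) {z : UpperIndex n → ℝ} {s : ℝ} (hz : ∀ e, |z e| ≤ s) :
    |D.truncSup τ z| ≤ |D.truncSup τ 0| + n * (n * (k * s)) := by
  have key : ∀ z₁ z₂ : UpperIndex n → ℝ, (∀ e, |(z₁ - z₂) e| ≤ s) →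
      D.truncSup τ z₁ - D.truncSup τ z₂ ≤ n * (n * (k * s)) := by
    intro z₁ z₂ h12
    refine le_of_forall_pos_le_add fun δ hδ => ?_
    obtain ⟨K, hK⟩ := D.exists_truncSup_sub_le τ z₁ hδ
    have h1 := (le_abs_self _).trans (D.abs_sum_truncCoef_mul_le τ K (z₁ - z₂))
    have h2 : ∑ i : Fin n, ∑ j : Fin n, k * |symArray (z₁ - z₂) i j| ≤
        ∑ _i : Fin n, ∑ _j : Fin n, k * s :=
      Finset.sum_le_sum fun i _ => Finset.sum_le_sum fun j _ =>
        mul_le_mul_of_nonneg_left (h12 (edge i j)) (Nat.cast_nonneg k)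
    have h3 : ∑ _i : Fin n, ∑ _j : Fin n, (k : ℝ) * s = n * (n * (k * s)) := by simp
    linarith [hK z₂]
  have h1 := key z 0 (by simpa using hz)
  have h2 := key 0 z (by simpa using hz)
  rw [abs_le]
  constructor
  · linarith [neg_abs_le (D.truncSup τ 0)]
  · linarith [le_abs_self (D.truncSup τ 0)]

/-- Truncation changes the supremum by at most the heavy part of the quadratic forms. -/
lemma abs_truncSup_one_sub_le [Nonempty κ] {τ s B : ℝ} {z : UpperIndex n → ℝ}
    {ξ : Fin n → Fin n → ℝ} (hs : 0 ≤ s) (hz : ∀ i j, |symArray z i j| ≤ s * ξ i j)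
    (hB : ∀ K l, ∑ i, ∑ j, (if τ < |D.v K l i| * |D.v K l j| then
      |D.v K l i| * |D.v K l j| * ξ i j else 0) ≤ B) :
    |D.truncSup 1 z - D.truncSup τ z| ≤ k * s * B := by
  have hdiff : ∀ K, |∑ i, ∑ j, D.truncCoef 1 K i j * symArray z i j -
      ∑ i, ∑ j, D.truncCoef τ K i j * symArray z i j| ≤ k * s * B := by
    intro K
    have hterm : ∀ i j, |(D.truncCoef 1 K i j - D.truncCoef τ K i j) * symArray z i j| ≤
        ∑ l, s * (if τ < |D.v K l i| * |D.v K l j| then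
          |D.v K l i| * |D.v K l j| * ξ i j else 0) := by
      intro i j
      unfold truncCoef
      rw [← Finset.sum_sub_distrib, Finset.sum_mul]
      refine (Finset.abs_sum_le_sum_abs _ _).trans (Finset.sum_le_sum fun l _ => ?_)
      have hle : |D.v K l i| * |D.v K l j| ≤ 1 :=
        mul_le_one₀ (D.abs_v_le_one K l i) (abs_nonneg _) (D.abs_v_le_one K l j)
      rw [if_pos hle]
      by_cases h : |D.v K l i| * |D.v K l j| ≤ τ
      · simp [h, not_lt.2 h]
      · rw [if_neg h, if_pos (not_le.1 h), sub_zero, abs_mul]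
        calc _ ≤ |D.v K l i| * |D.v K l j| * (s * ξ i j) :=
              mul_le_mul (D.abs_term_le K l i j) (hz i j) (abs_nonneg _) (by positivity)
          _ = _ := by ring
    rw [← Finset.sum_sub_distrib]
    simp_rw [← Finset.sum_sub_distrib, ← sub_mul]
    refine (Finset.abs_sum_le_sum_abs _ _).trans ?_
    calc _ ≤ ∑ i, ∑ j, ∑ l, s * (if τ < |D.v K l i| * |D.v K l j| then
          |D.v K l i| * |D.v K l j| * ξ i j else 0) := Finset.sum_le_sum fun i _ =>
          (Finset.abs_sum_le_sum_abs _ _).trans (Finset.sum_le_sum fun j _ => hterm i j)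
      _ = ∑ l, s * ∑ i, ∑ j, (if τ < |D.v K l i| * |D.v K l j| then
          |D.v K l i| * |D.v K l j| * ξ i j else 0) := by
          simp_rw [Finset.mul_sum]
          rw [Finset.sum_comm (s := (Finset.univ : Finset (Fin k)))]
          refine Finset.sum_congr rfl fun i _ => ?_
          rw [Finset.sum_comm]
      _ ≤ ∑ _l : Fin k, s * B := by gcongr with l; exact hB K l
      _ = k * s * B := by simp; ring
  rw [abs_le]
  constructor
  · have : D.truncSup τ z ≤ D.truncSup 1 z + k * s * B := ciSup_le fun K => by
      have h1 := D.le_truncSup 1 z K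
      have h2 := (abs_le.1 (hdiff K)).1
      linarith
    linarith
  · have : D.truncSup 1 z ≤ D.truncSup τ z + k * s * B := ciSup_le fun K => by
      have h1 := D.le_truncSup τ z K
      have h2 := (abs_le.1 (hdiff K)).2
      linarith
    linarith

end FlatFamily

/-! ### Concentration of suprema with flat slopes over independent entries. -/

namespace FlatFamily

variable {n k : ℕ} {ε : ℝ} {κ : Type*} [Nonempty κ] (D : FlatFamily n k ε κ)
  {α : Type*} [MeasurableSpace α] (μ : UpperIndex n → Measure α)
  [∀ e, IsProbabilityMeasure (μ e)] {a b : α → ℝ} {L η s : ℝ}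

lemma bddMeas_truncSup (ham : Measurable a) (ha : ∀ y, |a y| ≤ 1) (hbm : Measurable b)
    (hb : ∀ y, b y = 0 ∨ b y = 1) (hs : 0 ≤ s) (τ : ℝ) :
    BddMeas (fun ω : UpperIndex n → α => D.truncSup τ (fun e => s * (a (ω e) * b (ω e)))) := by
  refine ⟨(D.continuous_truncSup τ).measurable.comp (measurable_pi_lambda _ fun e =>
    ((ham.comp (measurable_pi_apply e)).mul (hbm.comp (measurable_pi_apply e))).const_mul s),
    _, fun ω => D.abs_truncSup_le τ (s := s) fun e => ?_⟩
  rw [abs_mul, abs_mul, abs_of_nonneg hs]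
  refine mul_le_of_le_one_right hs (mul_le_one₀ (ha _) (abs_nonneg _) ?_)
  rcases hb (ω e) with h | h <;> simp [h]

/-- Resampling one entry changes the truncated supremum by at most the slope coefficient there times
`s (a b - a' b')`, up to `δ`. Averaging over the new entry replaces its indicator by `p`, while the
old indicators give the light quadratic form. -/
lemma sum_sq_increments_le (h : Regime n L ε η) (ha : ∀ y, |a y| ≤ 1) (hbm : Measurable b)
    (hb : ∀ y, b y = 0 ∨ b y = 1) (hp : ∀ e, ∫ y, b y ∂(μ e) = Real.exp (-L))
    (ω : UpperIndex n → α) :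
    ∑ e, ∫ y, (max (D.truncSup (ε * η) (fun e' => s * (a (ω e') * b (ω e'))) -
      D.truncSup (ε * η) (fun e' => s * (a (Function.update ω e y e') *
        b (Function.update ω e y e')))) 0) ^ 2 ∂(μ e) ≤
      8 * s ^ 2 * k ^ 2 * (lightBound L ε η (symArray fun e => b (ω e)) + Real.exp (-L)) := by
  classical
  set z : UpperIndex n → ℝ := fun e' => s * (a (ω e') * b (ω e')) with hz
  set ξ : Fin n → Fin n → ℝ := symArray fun e => b (ω e) with hξdef
  have hbnn : ∀ y, 0 ≤ b y := fun y => by rcases hb y with h | h <;> simp [h]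
  have hξ : ∀ i j, 0 ≤ ξ i j := fun i j => hbnn _
  -- bound with an approximate maximiser
  have main : ∀ δ : ℝ, 0 < δ → δ ≤ 1 →
      ∑ e, ∫ y, (max (D.truncSup (ε * η) z - D.truncSup (ε * η) (fun e' =>
        s * (a (Function.update ω e y e') * b (Function.update ω e y e')))) 0) ^ 2 ∂(μ e) ≤
      8 * s ^ 2 * k ^ 2 * (lightBound L ε η ξ + Real.exp (-L)) +
        2 * Fintype.card (UpperIndex n) * δ := by
    intro δ hδ hδ1
    obtain ⟨K, hK⟩ := D.exists_truncSup_sub_le (ε * η) z hδ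
    set T : UpperIndex n → ℝ := fun e => ∑ q : Fin n × Fin n with edge q.1 q.2 = e,
      D.truncCoef (ε * η) K q.1 q.2 ^ 2 with hT
    have hT0 : ∀ e, 0 ≤ T e := fun e => Finset.sum_nonneg fun q _ => sq_nonneg _
    have hpt : ∀ e y, (max (D.truncSup (ε * η) z - D.truncSup (ε * η) (fun e' =>
        s * (a (Function.update ω e y e') * b (Function.update ω e y e')))) 0) ^ 2 ≤
        8 * s ^ 2 * T e * (b (ω e) + b y) + 2 * δ := by
      intro e y
      set z' : UpperIndex n → ℝ := fun e' =>
        s * (a (Function.update ω e y e') * b (Function.update ω e y e')) with hz'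
      set H := ∑ q : Fin n × Fin n with edge q.1 q.2 = e, D.truncCoef (ε * η) K q.1 q.2 with hH
      set d := s * (a (ω e) * b (ω e)) - s * (a y * b y) with hd
      have h1 : ∑ i, ∑ j, D.truncCoef (ε * η) K i j * symArray (z - z') i j = H * d := by
        rw [sum_mul_symArray, Finset.sum_eq_single e]
        · simp [hz, hz', hd, hH]
        · intro e' _ hne
          simp [hz, hz', Function.update_of_ne hne]
        · simp
      have h2 := hK z'
      rw [h1] at h2
      have h3 : max (D.truncSup (ε * η) z - D.truncSup (ε * η) z') 0 ≤ |H * d| + δ :=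
        max_le (h2.trans (by linarith [le_abs_self (H * d)])) (by positivity)
      -- `H` collects the positions `(i, j)` and `(j, i)`. This factor `2`, the one from `d²` and
      -- the one from splitting off `δ` make up the constant `8`.
      have hH2 : H ^ 2 ≤ 2 * T e := by
        refine sq_sum_le_card_mul_sum_sq.trans ?_
        exact mul_le_mul_of_nonneg_right (by exact_mod_cast card_edge_fiber_le e) (hT0 e)
      have hab : ∀ y, (a y * b y) ^ 2 ≤ b y := fun y => by
        have h4 : a y ^ 2 ≤ 1 := (sq_le_one_iff_abs_le_one _).2 (ha y)
        rcases hb y with h | h <;> simp [h]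
        exact ha y
      have hd2 : d ^ 2 ≤ 2 * s ^ 2 * (b (ω e) + b y) := by
        have e1 : d ^ 2 ≤ 2 * s ^ 2 * ((a (ω e) * b (ω e)) ^ 2 + (a y * b y) ^ 2) := by
          have : d ^ 2 + s ^ 2 * (a (ω e) * b (ω e) + a y * b y) ^ 2 =
            2 * s ^ 2 * ((a (ω e) * b (ω e)) ^ 2 + (a y * b y) ^ 2) := by rw [hd]; ring
          nlinarith [sq_nonneg (s * (a (ω e) * b (ω e) + a y * b y))]
        refine e1.trans ?_
        gcongr
        · exact hab _
        · exact hab _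
      calc _ ≤ (|H * d| + δ) ^ 2 := pow_le_pow_left₀ (le_max_right _ _) h3 2
        _ ≤ 2 * (H ^ 2 * d ^ 2) + 2 * δ ^ 2 := by
            have : |H * d| ^ 2 = H ^ 2 * d ^ 2 := by rw [sq_abs]; ring
            nlinarith [sq_nonneg (|H * d| - δ)]
        _ ≤ 2 * (2 * T e * (2 * s ^ 2 * (b (ω e) + b y))) + 2 * δ := by
            have e1 := mul_le_mul hH2 hd2 (sq_nonneg d) (by linarith [hT0 e])
            have e2 : δ ^ 2 ≤ δ := by nlinarith
            linarith
        _ = _ := by ring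
    have hintegral : ∀ e, ∫ y, (max (D.truncSup (ε * η) z - D.truncSup (ε * η) (fun e' =>
        s * (a (Function.update ω e y e') * b (Function.update ω e y e')))) 0) ^ 2 ∂(μ e) ≤
        8 * s ^ 2 * T e * (b (ω e) + Real.exp (-L)) + 2 * δ := by
      intro e
      have hbb := bddMeas_of_zero_or_one hbm hb
      have hR : BddMeas (fun y => 8 * s ^ 2 * T e * (b (ω e) + b y) + 2 * δ) :=
        (((BddMeas.const _).add hbb).const_mul _).add (BddMeas.const _)
      refine (integral_mono_of_nonneg (.of_forall fun y => sq_nonneg _) (hR.integrable (μ e))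
        (.of_forall (hpt e))).trans_eq ?_
      rw [integral_add ((((BddMeas.const _).add hbb).const_mul _).integrable _)
        (integrable_const _), integral_const_mul, integral_add (integrable_const _)
        (hbb.integrable _), hp]
      simp
    refine (Finset.sum_le_sum fun e _ => hintegral e).trans ?_
    have e1 : ∑ e, T e * b (ω e) = ∑ i, ∑ j, D.truncCoef (ε * η) K i j ^ 2 * ξ i j := by
      rw [hξdef, sum_mul_symArray]
    have e2 : ∑ e, T e = ∑ i, ∑ j, D.truncCoef (ε * η) K i j ^ 2 := by
      have := sum_mul_symArray (fun i j => D.truncCoef (ε * η) K i j ^ 2) (fun _ => 1)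
      simpa [symArray] using this.symm
    have h1 : ∑ e, T e * b (ω e) ≤ k ^ 2 * lightBound L ε η ξ := by
      rw [e1]
      exact D.sum_truncCoef_sq_mul_le _ K hξ fun l => h.light_sum_le hξ (symArray_comm _)
        (fun i => abs_nonneg _) (D.abs_v_le K l) (D.sum_abs_sq_le K l)
    have h2 : ∑ e, T e ≤ k ^ 2 := by rw [e2]; exact D.sum_truncCoef_sq_le _ K
    have e3 : ∑ e, (8 * s ^ 2 * T e * (b (ω e) + Real.exp (-L)) + 2 * δ) =
        8 * s ^ 2 * (∑ e, T e * b (ω e) + Real.exp (-L) * ∑ e, T e) +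
          2 * Fintype.card (UpperIndex n) * δ := by
      rw [Finset.sum_add_distrib]
      congr 1
      · rw [Finset.mul_sum _ _ (Real.exp (-L)), ← Finset.sum_add_distrib, Finset.mul_sum]
        exact Finset.sum_congr rfl fun e _ => by ring
      · simp; ring
    rw [e3]
    have h3 := mul_le_mul_of_nonneg_left h2 (Real.exp_pos (-L)).le
    have h4 : 8 * s ^ 2 * (∑ e, T e * b (ω e) + Real.exp (-L) * ∑ e, T e) ≤
        8 * s ^ 2 * (k ^ 2 * lightBound L ε η ξ + Real.exp (-L) * k ^ 2) := by
      gcongr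
    linarith
  refine le_of_forall_pos_le_add fun δ hδ => ?_
  have hc : (0 : ℝ) < 2 * Fintype.card (UpperIndex n) + 1 := by positivity
  refine (main (min 1 (δ / (2 * Fintype.card (UpperIndex n) + 1))) (by positivity)
    (min_le_left _ _)).trans ?_
  have h1 : 2 * (Fintype.card (UpperIndex n) : ℝ) *
      min 1 (δ / (2 * Fintype.card (UpperIndex n) + 1)) ≤ δ := by
    calc _ ≤ (2 * (Fintype.card (UpperIndex n) : ℝ) + 1) *
          (δ / (2 * Fintype.card (UpperIndex n) + 1)) := by
          refine mul_le_mul (by linarith) (min_le_right _ _) (by positivity) hc.le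
      _ = δ := by field_simp
  linarith

/-- Concentration of a supremum of affine functions with flat slopes on the product space. -/
theorem measureReal_truncSup_le (h : Regime n L ε η) (ham : Measurable a) (ha : ∀ y, |a y| ≤ 1)
    (hbm : Measurable b) (hb : ∀ y, b y = 0 ∨ b y = 1)
    (hp : ∀ e, ∫ y, b y ∂(μ e) = Real.exp (-L)) (hs : 0 ≤ s) {t r : ℝ} (hr : 0 < r)
    (hrt : 20800 * k ^ 2 * s ^ 2 * ε ^ 2 * r = t / 4)
    (h1 : 16 * r ^ 2 * s ^ 2 * k ^ 2 * (528 * (ε * η) ^ 2 / L) ≤ 1)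
    (h2 : r * (k * s) * (2048 * η / (ε * L)) ≤ 1) (h3 : k * s * (8400 * (ε / η)) ≤ t / 16) :
    (Measure.pi μ).real {ω | t < D.truncSup 1 (fun e => s * (a (ω e) * b (ω e))) -
      ∫ ω', D.truncSup 1 (fun e => s * (a (ω' e) * b (ω' e))) ∂(Measure.pi μ)} ≤
      2 * Real.exp (-(3 / 16 * (r * t))) := by
  classical
  set P := Measure.pi μ
  have hL := h.L_large
  have hL0 : 0 < L := by linarith
  have hε := h.ε_pos
  have hη := h.η_pos
  set F : (UpperIndex n → α) → ℝ := fun ω => D.truncSup 1 (fun e => s * (a (ω e) * b (ω e)))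
  set g : (UpperIndex n → α) → ℝ := fun ω =>
    D.truncSup (ε * η) (fun e => s * (a (ω e) * b (ω e)))
  have hF : BddMeas F := D.bddMeas_truncSup ham ha hbm hb hs 1
  have hg : BddMeas g := D.bddMeas_truncSup ham ha hbm hb hs (ε * η)
  -- The number of shells `q + 1` satisfies `1 / ε² ≤ 2 ^ (q + 1) ≤ 2 / ε²`, so the tail beyond the
  -- last shell is at most `ε / η`.
  obtain ⟨q, hq1, hq2⟩ := exists_nat_pow_near (x := 1 / ε ^ 2) (y := (2 : ℝ))
    ((one_le_div (by positivity)).2 (pow_le_one₀ hε.le h.ε_le)) (by norm_num)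
  have hQ' : (2 : ℝ) ^ (q + 1) ≤ 2 / ε ^ 2 := by
    rw [pow_succ]
    calc (2 : ℝ) ^ q * 2 ≤ 1 / ε ^ 2 * 2 := by gcongr
      _ = _ := by ring
  set H : (UpperIndex n → α) → ℝ := fun ω =>
    k * s * heavyBound L ε η (q + 1) (symArray fun e => b (ω e))
  have hH : BddMeas H := (Regime.bddMeas_heavyBound hbm hb (q + 1)).const_mul _
  have hks : 0 ≤ k * s := by positivity
  have hFg : ∀ ω, |F ω - g ω| ≤ H ω := fun ω => by
    have hbnn : ∀ y, 0 ≤ b y := fun y => by rcases hb y with h | h <;> simp [h]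
    refine D.abs_truncSup_one_sub_le (ξ := symArray fun e => b (ω e)) hs (fun i j => ?_)
      fun K l => h.heavy_sum_le hq2.le hQ' (fun i j => hbnn _)
        (fun i j => ?_) (fun i => abs_nonneg _) (D.abs_v_le K l) (D.sum_abs_sq_le K l)
    · simp only [symArray]
      rw [abs_mul, abs_mul, abs_of_nonneg hs, abs_of_nonneg (hbnn _)]
      exact mul_le_mul_of_nonneg_left (mul_le_of_le_one_left (hbnn _) (ha _)) hs
    · rcases hb (ω (edge i j)) with h | h <;> simp [h]
  -- exponential moment of the heavy part
  have hHexp : ∫ ω, Real.exp (r * H ω) ∂P ≤ Real.exp (r * t / 16) := by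
    have := h.integral_exp_heavyBound_le μ hbm hb hp hQ' (r := r * (k * s)) (by positivity) h2
    have e1 : ∀ ω, r * H ω =
        r * (k * s) * heavyBound L ε η (q + 1) (symArray fun e => b (ω e)) := fun ω => by
      change r * (k * s * heavyBound L ε η (q + 1) (symArray fun e => b (ω e))) = _; ring
    simp_rw [e1]
    refine this.trans (Real.exp_le_exp.2 ?_)
    have := mul_le_mul_of_nonneg_left h3 hr.le
    linarith
  have hHmean : ∫ ω, H ω ∂P ≤ t / 16 := by
    have e1 := integral_le_log_integral_exp P (hH.const_mul r)
    rw [integral_const_mul] at e1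
    have e2 := Real.log_le_log (integral_exp_pos_of_bddMeas P (hH.const_mul r)) hHexp
    rw [Real.log_exp] at e2
    have e3 : r * ∫ ω, H ω ∂P ≤ r * (t / 16) := by linarith
    exact le_of_mul_le_mul_left e3 hr
  -- exponential moment of the truncated function
  have hgexp : ∫ ω, Real.exp (r * g ω) ∂P ≤ Real.exp (r * ∫ ω, g ω ∂P + r * t / 4) := by
    have hV : BddMeas (fun ω : UpperIndex n → α => 8 * s ^ 2 * k ^ 2 *
        (lightBound L ε η (symArray fun e => b (ω e)) + Real.exp (-L))) :=
      ((Regime.bddMeas_lightBound hbm hb).add (BddMeas.const _)).const_mul _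
    -- The constant is `16 (1200 + 100)`: `2 · 8` from the variance proxy, `1200` from the light
    -- form and `100` from the resampled entries.
    have key := log_integral_exp_le_of_sum_sq_le μ hg hV
      (fun ω => D.sum_sq_increments_le μ h ha hbm hb hp ω)
      (C := 20800 * k ^ 2 * s ^ 2 * ε ^ 2) hr ?_
    · rw [Real.log_le_iff_le_exp (integral_exp_pos_of_bddMeas P (hg.const_mul r))] at key
      refine key.trans (Real.exp_le_exp.2 (le_of_eq ?_))
      rw [pow_two r, ← mul_assoc, hrt]
      ring
    · intro u hu hur
      have hR := h.integral_exp_lightBound_le μ hbm hb hp (r := 16 * u ^ 2 * s ^ 2 * k ^ 2)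
        (by positivity) (le_trans (by gcongr) h1)
      have hpε : Real.exp (-L) ≤ 100 * ε ^ 2 := by
        have e1 := h.inv_sq_le
        rw [div_le_iff₀ (by positivity)] at e1
        have e2 := exp_mul_sq_le hL
        have e3 : Real.exp (-L) ≤ Real.exp (-(3 / 4 * L)) := Real.exp_le_exp.2 (by linarith)
        have e4 : Real.exp (-L) * L ≤ 1 := by
          have := Real.exp_pos (-(3 / 4 * L))
          nlinarith
        have e5 : Real.exp (-L) * L ≤ L * ε ^ 2 := e4.trans e1
        have : Real.exp (-L) ≤ ε ^ 2 := by
          rw [mul_comm] at e5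
          exact le_of_mul_le_mul_left e5 hL0
        nlinarith [sq_nonneg ε]
      have e1 : ∀ ω : UpperIndex n → α, Real.exp (2 * u ^ 2 * (8 * s ^ 2 * k ^ 2 *
          (lightBound L ε η (symArray fun e => b (ω e)) + Real.exp (-L)))) =
          Real.exp (16 * u ^ 2 * s ^ 2 * k ^ 2 * Real.exp (-L)) *
          Real.exp (16 * u ^ 2 * s ^ 2 * k ^ 2 *
            lightBound L ε η (symArray fun e => b (ω e))) := fun ω => by
        rw [← Real.exp_add]
        congr 1
        ring
      simp_rw [e1]
      rw [integral_const_mul, Real.log_mul (Real.exp_pos _).ne'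
        (integral_exp_pos_of_bddMeas _ ((Regime.bddMeas_lightBound hbm hb).const_mul _)).ne',
        Real.log_exp]
      have e2 := Real.log_le_log (integral_exp_pos_of_bddMeas (Measure.pi μ)
        ((Regime.bddMeas_lightBound hbm hb).const_mul _)) hR
      rw [Real.log_exp] at e2
      have e3 : 16 * u ^ 2 * s ^ 2 * k ^ 2 * Real.exp (-L) ≤
          16 * u ^ 2 * s ^ 2 * k ^ 2 * (100 * ε ^ 2) := by gcongr
      refine (add_le_add e3 e2).trans_eq ?_
      ring
  -- Replacing `F` by `g` costs `H` pointwise and at most `t / 16` in the mean; outside both events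
  -- the deviation would be below `t / 2 + t / 4 + t / 16`.
  have hsub : {ω | t < F ω - ∫ ω', F ω' ∂P} ⊆
      {ω | t / 2 + ∫ ω', g ω' ∂P ≤ g ω} ∪ {ω | t / 4 ≤ H ω} := by
    intro ω hω
    by_contra hcon
    simp only [Set.mem_union, Set.mem_ofPred_eq, not_or, not_le] at hcon hω
    have e1 := (abs_le.1 (hFg ω)).2
    have e2 : ∫ ω', g ω' ∂P - ∫ ω', H ω' ∂P ≤ ∫ ω', F ω' ∂P := by
      rw [← integral_sub (hg.integrable P) (hH.integrable P)]
      refine integral_mono ((hg.sub hH).integrable P) (hF.integrable P) fun ω' => ?_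
      have := (abs_le.1 (hFg ω')).1
      simp only
      linarith
    have ht : 0 ≤ t := by
      have : 0 ≤ t / 4 := by rw [← hrt]; positivity
      linarith
    linarith [hcon.1, hcon.2]
  have hP1 : P.real {ω | t / 2 + ∫ ω', g ω' ∂P ≤ g ω} ≤ Real.exp (-(3 / 16 * (r * t))) := by
    refine (measure_ge_le_exp_mul_mgf _ hr.le ((hg.const_mul r).exp.integrable P)).trans ?_
    refine (mul_le_mul_of_nonneg_left hgexp (Real.exp_pos _).le).trans ?_
    rw [← Real.exp_add]
    refine Real.exp_le_exp.2 ?_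
    have ht : 0 ≤ r * t := by
      have : 0 ≤ r * (t / 4) := by rw [← hrt]; positivity
      linarith
    linarith
  have hP2 : P.real {ω | t / 4 ≤ H ω} ≤ Real.exp (-(3 / 16 * (r * t))) := by
    refine (measure_ge_le_exp_mul_mgf _ hr.le ((hH.const_mul r).exp.integrable P)).trans ?_
    refine (mul_le_mul_of_nonneg_left hHexp (Real.exp_pos _).le).trans ?_
    rw [← Real.exp_add]
    refine Real.exp_le_exp.2 ?_
    linarith
  calc _ ≤ P.real ({ω | t / 2 + ∫ ω', g ω' ∂P ≤ g ω} ∪ {ω | t / 4 ≤ H ω}) :=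
        measureReal_mono hsub
    _ ≤ _ := measureReal_union_le _ _
    _ ≤ _ := by linarith

end FlatFamily

/-! ### Reduction of the model to a product space -/

lemma measurable_entry {n : ℕ} (i j : Fin n) : Measurable fun K : SymMat n => K.1 i j :=
  (measurable_pi_apply j).comp ((measurable_pi_apply i).comp
    (comap_measurable fun K : SymMat n => fun i j => K.1 i j))

/-- The entries on and above the diagonal. -/
def upper {n : ℕ} (K : SymMat n) (e : UpperIndex n) : ℝ := K.1 e.1.1 e.1.2

lemma measurable_upper {n : ℕ} : Measurable (upper (n := n)) :=
  measurable_pi_lambda _ fun e => measurable_entry e.1.1 e.1.2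

lemma symArray_upper {n : ℕ} (K : SymMat n) (i j : Fin n) : symArray (upper K) i j = K.1 i j := by
  rcases le_total i j with h | h
  · simp [symArray, upper, edge, h]
  · simp only [symArray, upper, edge, min_eq_right h, max_eq_left h]
    exact K.2.apply i j

/-- The symmetric matrix with given entries on and above the diagonal. -/
def ofUpper {n : ℕ} (z : UpperIndex n → ℝ) : SymMat n :=
  ⟨symArray z, by ext i j; exact symArray_comm z j i⟩

lemma traceInner_eq_sum {n : ℕ} (A B : SymMat n) :
    traceInner A B = ∑ i, ∑ j, A.1 i j * B.1 i j := by
  simp only [traceInner, Matrix.trace, Matrix.diag_apply, Matrix.mul_apply]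
  exact Finset.sum_congr rfl fun i _ => Finset.sum_congr rfl fun j _ => by rw [B.2.apply i j]

lemma traceInner_sub {n : ℕ} (A B C : SymMat n) :
    traceInner A (B - C) = traceInner A B - traceInner A C := by
  simp only [traceInner_eq_sum, ← Finset.sum_sub_distrib]
  exact Finset.sum_congr rfl fun i _ => Finset.sum_congr rfl fun j _ => mul_sub _ _ _

/-- A function with a flat subgradient is a supremum of affine functions with flat slopes. -/
lemma exists_flatFamily {n k : ℕ} {ε : ℝ} {f : SymMat n → ℝ} {ζ : SymMat n → SymMat n}
    (hζ : ∀ K, ζ K ∈ flat n k ε) (hf : ∀ K K', f K - f K' ≤ traceInner (ζ K) (K - K')) :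
    ∃ D : FlatFamily n k ε (SymMat n), ∀ z, D.truncSup 1 z = f (ofUpper z) := by
  choose θ v hθ hv hA using hζ
  let D : FlatFamily n k ε (SymMat n) :=
    { c := fun K => f K - traceInner (ζ K) K
      θ := θ
      v := fun K l i => v K l i
      c_le := ⟨f 0, fun K => by
        have := hf K 0
        rw [sub_zero] at this
        linarith⟩
      abs_θ_le := hθ
      abs_v_le := fun K l i => (hv K l).2 i
      sum_sq_le := fun K l => by
        have h1 := (hv K l).1
        rw [EuclideanSpace.norm_eq, Real.sqrt_le_one] at h1
        simpa using h1 }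
  refine ⟨D, fun z => ?_⟩
  have hcoef : ∀ K i j, D.truncCoef 1 K i j = (ζ K).1 i j := fun K i j => by
    rw [hA K, Matrix.sum_apply]
    refine Finset.sum_congr rfl fun l _ => ?_
    -- Entries are at most `1`, so truncation at level `1` removes nothing.
    rw [if_pos (mul_le_one₀ (D.abs_v_le_one K l i) (abs_nonneg _) (D.abs_v_le_one K l j))]
    simp [Matrix.vecMulVec_apply, D]
  have hsum : ∀ K, ∑ i, ∑ j, D.truncCoef 1 K i j * symArray z i j =
      traceInner (ζ K) (ofUpper z) := fun K => by
    rw [traceInner_eq_sum]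
    simp_rw [hcoef]
    rfl
  -- Every supporting affine function lies below `f`, and the one based at `ofUpper z` touches it
  -- there.
  refine le_antisymm (ciSup_le fun K => ?_) ?_
  · rw [hsum]
    have := hf K (ofUpper z)
    rw [traceInner_sub] at this
    simp only [D]
    linarith
  · have := D.le_truncSup 1 z (ofUpper z)
    rw [hsum] at this
    simp only [D] at this
    linarith

/-- Truncation of a real number to `[-1, 1]`. -/
def clip (y : ℝ × ℝ) : ℝ := max (-1) (min 1 y.1)

/-- Indicator that the second coordinate is `1`. -/
noncomputable def isOne (y : ℝ × ℝ) : ℝ := if y.2 = 1 then 1 else 0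

lemma measurable_clip : Measurable clip := by unfold clip; fun_prop

lemma abs_clip_le (y : ℝ × ℝ) : |clip y| ≤ 1 :=
  abs_le.2 ⟨le_max_left _ _, max_le (by norm_num) (min_le_left _ _)⟩

lemma clip_of_abs_le {y : ℝ × ℝ} (h : |y.1| ≤ 1) : clip y = y.1 := by
  rw [abs_le] at h
  rw [clip, min_eq_right h.2, max_eq_right h.1]

lemma measurable_isOne : Measurable isOne :=
  Measurable.ite (measurable_snd (measurableSet_singleton (1 : ℝ))) measurable_const
    measurable_const

lemma isOne_eq (y : ℝ × ℝ) : isOne y = 0 ∨ isOne y = 1 := by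
  unfold isOne
  split_ifs <;> simp

/-- The pairs of entries of the two matrices. -/
def entryPairs {n : ℕ} (A B : SymMat n) (e : UpperIndex n) : ℝ × ℝ := (upper A e, upper B e)

namespace IsBoundedSparseModel

variable {Ω : Type*} [MeasurableSpace Ω] {P : Measure Ω} {n : ℕ} {p : I}
  {G Ξ : Ω → SymMat n}

lemma measurable_entryPairs (hM : IsBoundedSparseModel P p G Ξ) :
    Measurable fun ω => entryPairs (G ω) (Ξ ω) :=
  measurable_pi_lambda _ fun e =>
    ((measurable_pi_apply e).comp (measurable_upper.comp hM.measurable_G)).prodMk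
      ((measurable_pi_apply e).comp (measurable_upper.comp hM.measurable_Ξ))

/-- Independence of the two matrices and of the entries within each makes the pairs of entries
independent over the positions. -/
lemma map_entryPairs [IsProbabilityMeasure P] (hM : IsBoundedSparseModel P p G Ξ) :
    P.map (fun ω => entryPairs (G ω) (Ξ ω)) = Measure.pi fun e : UpperIndex n =>
      (P.map fun ω => upper (G ω) e).prod (P.map fun ω => upper (Ξ ω) e) := by
  have hGm : Measurable fun ω => upper (G ω) := measurable_upper.comp hM.measurable_G
  have hΞm : Measurable fun ω => upper (Ξ ω) := measurable_upper.comp hM.measurable_Ξ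
  have hGe : ∀ e, Measurable fun ω => upper (G ω) e := fun e => (measurable_pi_apply e).comp hGm
  have hΞe : ∀ e, Measurable fun ω => upper (Ξ ω) e := fun e => (measurable_pi_apply e).comp hΞm
  have h1 := (indepFun_iff_map_prod_eq_prod_map_map hGm.aemeasurable hΞm.aemeasurable).1
    (hM.indep.comp measurable_upper measurable_upper)
  have hG : P.map (fun ω => upper (G ω)) = Measure.pi fun e => P.map fun ω => upper (G ω) e :=
    iIndepFun.map_fun_eq_pi_map (fun e => (hGe e).aemeasurable) hM.indep_G
  have hΞ : P.map (fun ω => upper (Ξ ω)) = Measure.pi fun e => P.map fun ω => upper (Ξ ω) e :=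
    iIndepFun.map_fun_eq_pi_map (fun e => (hΞe e).aemeasurable) hM.indep_Ξ
  have : ∀ e, IsProbabilityMeasure (P.map fun ω => upper (G ω) e) := fun e =>
    Measure.isProbabilityMeasure_map (hGe e).aemeasurable
  have : ∀ e, IsProbabilityMeasure (P.map fun ω => upper (Ξ ω) e) := fun e =>
    Measure.isProbabilityMeasure_map (hΞe e).aemeasurable
  have h2 := (measurePreserving_arrowProdEquivProdArrow ℝ ℝ (UpperIndex n)
    (fun e => P.map fun ω => upper (G ω) e) (fun e => P.map fun ω => upper (Ξ ω) e)).symm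
  rw [← h2.map_eq, ← hG, ← hΞ]
  have h3 : P.map (fun ω => (upper (G ω), upper (Ξ ω))) =
      (P.map fun ω => upper (G ω)).prod (P.map fun ω => upper (Ξ ω)) := h1
  rw [← h3, Measure.map_map (MeasurableEquiv.measurable _) (hGm.prodMk hΞm)]
  rfl

lemma ae_eq_zero_or_one (hM : IsBoundedSparseModel P p G Ξ) (i j : Fin n) :
    ∀ᵐ ω ∂P, (Ξ ω).1 i j = 0 ∨ (Ξ ω).1 i j = 1 := by
  have h1 := hM.bernoulli_Ξ i j
  have hms : MeasurableSet ({0, 1}ᶜ : Set ℝ) := (Set.toFinite _).measurableSet.compl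
  have h2 : (bernoulliMeasure (1 : ℝ) 0 p) ({0, 1}ᶜ : Set ℝ) = 0 :=
    bernoulliMeasure_apply_of_notMem_of_notMem p hms (by simp) (by simp)
  rw [← h1.map_eq, Measure.map_apply_of_aemeasurable h1.aemeasurable hms] at h2
  rw [ae_iff]
  convert h2 using 2
  ext ω
  simp

lemma integral_isOne [IsProbabilityMeasure P] (hM : IsBoundedSparseModel P p G Ξ) (e : UpperIndex n) :
    ∫ y, isOne y ∂((P.map fun ω => upper (G ω) e).prod (P.map fun ω => upper (Ξ ω) e)) = p := by
  have hGe : Measurable fun ω => upper (G ω) e :=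
    (measurable_pi_apply e).comp (measurable_upper.comp hM.measurable_G)
  have : IsProbabilityMeasure (P.map fun ω => upper (G ω) e) :=
    Measure.isProbabilityMeasure_map hGe.aemeasurable
  have h1 : (P.map fun ω => upper (Ξ ω) e) = bernoulliMeasure (1 : ℝ) 0 p :=
    (hM.bernoulli_Ξ e.1.1 e.1.2).map_eq
  rw [h1]
  have h2 := integral_fun_snd (μ := P.map fun ω => upper (G ω) e)
    (ν := bernoulliMeasure (1 : ℝ) 0 p) (fun x : ℝ => if x = 1 then (1 : ℝ) else 0)
  unfold isOne
  rw [h2, integral_bernoulliMeasure]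
  simp

/-- `clip` and `isOne` turn the almost sure bounds on the entries into bounds valid everywhere, as
the product space argument requires. -/
lemma ae_sparse_eq (hM : IsBoundedSparseModel P p G Ξ) :
    ∀ᵐ ω ∂P, sparse p (G ω) (Ξ ω) = ofUpper fun e => (Real.sqrt (n * p))⁻¹ *
      (clip (entryPairs (G ω) (Ξ ω) e) * isOne (entryPairs (G ω) (Ξ ω) e)) := by
  have h1 : ∀ᵐ ω ∂P, ∀ i j, |(G ω).1 i j| ≤ 1 :=
    ae_all_iff.2 fun i => ae_all_iff.2 fun j => hM.bounded_G i j
  have h2 : ∀ᵐ ω ∂P, ∀ i j, (Ξ ω).1 i j = 0 ∨ (Ξ ω).1 i j = 1 :=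
    ae_all_iff.2 fun i => ae_all_iff.2 fun j => hM.ae_eq_zero_or_one i j
  filter_upwards [h1, h2] with ω hG hΞ
  apply Subtype.ext
  ext i j
  have hc : clip (entryPairs (G ω) (Ξ ω) (edge i j)) = (G ω).1 i j := by
    rw [← symArray_upper (G ω) i j]
    exact clip_of_abs_le (hG _ _)
  have ho : isOne (entryPairs (G ω) (Ξ ω) (edge i j)) = (Ξ ω).1 i j := by
    have e1 : (entryPairs (G ω) (Ξ ω) (edge i j)).2 = (Ξ ω).1 i j := symArray_upper (Ξ ω) i j
    unfold isOne
    rw [e1]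
    rcases hΞ i j with h | h <;> simp [h]
  change (Real.sqrt (n * p))⁻¹ * ((G ω).1 i j * (Ξ ω).1 i j) = (Real.sqrt (n * p))⁻¹ *
    (clip (entryPairs (G ω) (Ξ ω) (edge i j)) * isOne (entryPairs (G ω) (Ξ ω) (edge i j)))
  rw [hc, ho]

end IsBoundedSparseModel

/-! ### The choice of parameters -/

set_option maxHeartbeats 1000000 in
/-- The conditions on the parameters required for concentration. -/
lemma exists_regime {k n : ℕ} (hk : 1 ≤ k) {p ε t : ℝ} (hn : 2 ≤ n)
    (hnp : 4 * Real.log n ≤ n * p) (hp : p ≤ 1 / 2) (hε : 0 < ε) (hε3 : ε < 1 / 3)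
    (ht : 2000000 * (k : ℝ) ^ 2 / Real.sqrt (Real.log (1 / p)) ≤ t)
    (ht1 : t ≤ 1 / (2000000 * (k : ℝ) ^ 2))
    (htε : Real.log (t ^ 2 * Real.log (1 / p)) / (t * Real.sqrt (Real.log (1 / p))) ≤ ε) :
    ∃ L η r : ℝ, p = Real.exp (-L) ∧ Regime n L ε η ∧ 0 < r ∧
      20800 * k ^ 2 * (Real.sqrt (n * p))⁻¹ ^ 2 * ε ^ 2 * r = t / 4 ∧
      16 * r ^ 2 * (Real.sqrt (n * p))⁻¹ ^ 2 * k ^ 2 * (528 * (ε * η) ^ 2 / L) ≤ 1 ∧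
      r * (k * (Real.sqrt (n * p))⁻¹) * (2048 * η / (ε * L)) ≤ 1 ∧
      k * (Real.sqrt (n * p))⁻¹ * (8400 * (ε / η)) ≤ t / 16 ∧
      t ^ 2 * (n * p) / (2000000 * (k : ℝ) ^ 2 * ε ^ 2) ≤ 3 / 16 * (r * t) := by
  have hk1 : (1 : ℝ) ≤ k := by exact_mod_cast hk
  have hn2 : (2 : ℝ) ≤ n := by exact_mod_cast hn
  have hlogn : 1 / 2 ≤ Real.log n := by
    have := Real.log_two_gt_d9
    have := Real.log_le_log (by norm_num) hn2
    linarith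
  have hnp0 : 0 < n * p := by linarith
  have hp0 : 0 < p := (pos_iff_pos_of_mul_pos hnp0).1 (by linarith)
  set L := Real.log (1 / p) with hLdef
  have hpL : p = Real.exp (-L) := by
    rw [hLdef, one_div, Real.log_inv, neg_neg, Real.exp_log hp0]
  have hL0 : 0 < L := Real.log_pos (by rw [lt_div_iff₀ hp0]; linarith)
  -- Since `np ≥ 4 log n ≥ 1`, `1 / p ≤ n`. This later yields `4 L ≤ np`.
  have hLn : L ≤ Real.log n := by
    refine Real.log_le_log (by positivity) ?_
    rw [div_le_iff₀ hp0]
    linarith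
  have hsL : 0 < Real.sqrt L := Real.sqrt_pos.2 hL0
  have hsL2 : Real.sqrt L ^ 2 = L := Real.sq_sqrt hL0.le
  rw [div_le_iff₀ hsL] at ht
  have hk2 : (1 : ℝ) ≤ (k : ℝ) ^ 2 := one_le_pow₀ hk1
  have hγ : (2000000 : ℝ) ≤ 2000000 * (k : ℝ) ^ 2 := by linarith
  have htsL : 0 < t * Real.sqrt L := by linarith
  have ht0 : 0 < t := (pos_iff_pos_of_mul_pos htsL).2 hsL
  have htL : (2000000 * (k : ℝ) ^ 2) ^ 2 ≤ t ^ 2 * L := by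
    rw [← hsL2, ← mul_pow]
    exact pow_le_pow_left₀ (by positivity) ht 2
  rw [le_div_iff₀ (by positivity)] at ht1
  have ht2 : t ≤ 1 := by nlinarith
  have htγ : t ^ 2 * (2000000 * (k : ℝ) ^ 2) ^ 2 ≤ 1 := by
    rw [← mul_pow]
    exact pow_le_one₀ (by positivity) ht1
  have hk4 : (k : ℝ) ^ 2 ≤ ((k : ℝ) ^ 2) ^ 2 := by nlinarith
  have htL1 : 4000000000000 * (k : ℝ) ^ 2 ≤ t ^ 2 * L := by
    calc 4000000000000 * (k : ℝ) ^ 2 ≤ 4000000000000 * ((k : ℝ) ^ 2) ^ 2 := by gcongr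
      _ = (2000000 * (k : ℝ) ^ 2) ^ 2 := by ring
      _ ≤ _ := htL
  have htsq : t ^ 2 ≤ 1 := pow_le_one₀ ht0.le ht2
  have hL48 : 4000000000000 * (k : ℝ) ^ 2 ≤ L := htL1.trans (by nlinarith)
  -- The numerator `log (t² L)` is at least `1`, so the lower bound on `ε` gives `1 / ε² ≤ t² L`.
  have hεtL : 1 ≤ ε * (t * Real.sqrt L) := by
    rw [div_le_iff₀ (by positivity)] at htε
    refine le_trans ?_ htε
    rw [Real.le_log_iff_exp_le (by positivity)]
    have := Real.exp_one_lt_d9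
    linarith
  have hmt : 1 / ε ^ 2 ≤ t ^ 2 * L := by
    rw [div_le_iff₀ (by positivity)]
    calc (1 : ℝ) ≤ (ε * (t * Real.sqrt L)) ^ 2 := one_le_pow₀ hεtL
      _ = t ^ 2 * Real.sqrt L ^ 2 * ε ^ 2 := by ring
      _ = _ := by rw [hsL2]
  set w := Real.sqrt (n * p) with hw
  have hw0 : 0 < w := Real.sqrt_pos.2 hnp0
  have hw2 : w ^ 2 = n * p := Real.sq_sqrt hnp0.le
  have hk0 : (0 : ℝ) < k := by linarith
  have htw : 4 * (t ^ 2 * L) ≤ t ^ 2 * w ^ 2 := by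
    rw [hw2]
    have : 4 * L ≤ n * p := by linarith
    nlinarith [sq_nonneg t]
  have hpLle : p * L ≤ 1 := by
    have h1 := Real.add_one_le_exp L
    calc p * L ≤ Real.exp (-L) * Real.exp L := by
          rw [← hpL]; gcongr; linarith
      _ = 1 := by rw [← Real.exp_add]; simp
  have h40 : 40000000000 * (k : ℝ) ^ 2 ≤ t ^ 2 * L := by linarith
  have hε1 : ε ^ 2 ≤ 1 := pow_le_one₀ hε.le (by linarith)
  have hbη : 1 / (200000 * k * ε / (t * w)) ^ 2 =
      t ^ 2 * w ^ 2 / (40000000000 * k ^ 2 * ε ^ 2) := by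
    field_simp
    norm_num
  -- `η` is chosen to make the heavy part `8400 / 200000 · t`, below `t / 16`. `r` solves `20800 k²
  -- s² ε² r = t / 4`, with `83200 = 4 · 20800`.
  refine ⟨L, 200000 * k * ε / (t * w), t * w ^ 2 / (83200 * k ^ 2 * ε ^ 2), hpL,
    ⟨by omega, by linarith, hε, by linarith, hmt.trans (by nlinarith), by positivity, ?_, ?_, ?_⟩,
    by positivity, ?_, ?_, ?_, ?_, ?_⟩
  · rw [div_le_one (by positivity)]
    refine (sq_le_sq₀ (by positivity) (by positivity)).1 ?_
    calc (200000 * k * ε) ^ 2 = 40000000000 * (k : ℝ) ^ 2 * ε ^ 2 := by ring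
      _ ≤ 40000000000 * (k : ℝ) ^ 2 * 1 := by gcongr
      _ ≤ t ^ 2 * w ^ 2 := by linarith
      _ = (t * w) ^ 2 := by ring
  · rw [hbη, le_div_iff₀ (by positivity)]
    have e1 : (n : ℝ) * Real.exp (-(2 * L)) = w ^ 2 * p := by
      rw [hw2, show -(2 * L) = -L + -L by ring, Real.exp_add, ← hpL]; ring
    rw [e1]
    have e2 : p * (40000000000 * k ^ 2 * ε ^ 2) ≤ t ^ 2 := by
      calc p * (40000000000 * k ^ 2 * ε ^ 2) ≤ p * (t ^ 2 * L * 1) :=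
            mul_le_mul_of_nonneg_left (mul_le_mul h40 hε1 (by positivity) (by positivity)) hp0.le
        _ = t ^ 2 * (p * L) := by ring
        _ ≤ t ^ 2 * 1 := by gcongr
        _ = t ^ 2 := mul_one _
    calc w ^ 2 * p * (40000000000 * k ^ 2 * ε ^ 2) =
        w ^ 2 * (p * (40000000000 * k ^ 2 * ε ^ 2)) := by ring
      _ ≤ w ^ 2 * t ^ 2 := by gcongr
      _ = _ := by ring
  · rw [hbη]
    calc 4 * (1 / ε ^ 2) * Real.log n = 1 / ε ^ 2 * (4 * Real.log n) := by ring
      _ ≤ 1 / ε ^ 2 * w ^ 2 := by rw [hw2]; gcongr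
      _ = 40000000000 * k ^ 2 * (w ^ 2 / (40000000000 * k ^ 2 * ε ^ 2)) := by field_simp
      _ ≤ t ^ 2 * L * (w ^ 2 / (40000000000 * k ^ 2 * ε ^ 2)) :=
          mul_le_mul_of_nonneg_right h40 (by positivity)
      _ = _ := by ring
  · field_simp
    norm_num
  · have e1 : 16 * (t * w ^ 2 / (83200 * k ^ 2 * ε ^ 2)) ^ 2 * w⁻¹ ^ 2 * k ^ 2 *
        (528 * (ε * (200000 * k * ε / (t * w))) ^ 2 / L) =
        16 * 528 * 200000 ^ 2 / 83200 ^ 2 / L := by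
      field_simp
    rw [e1, div_le_one hL0]
    refine le_trans ?_ (le_trans (by linarith : (4000000000000 : ℝ) ≤ _) hL48)
    norm_num
  · have e1 : t * w ^ 2 / (83200 * k ^ 2 * ε ^ 2) * (k * w⁻¹) *
        (2048 * (200000 * k * ε / (t * w)) / (ε * L)) =
        2048 * 200000 / 83200 * (1 / ε ^ 2) / L := by
      field_simp
    rw [e1, div_le_one hL0]
    have e2 : t ^ 2 * 4000000000000 ≤ 1 := by
      refine le_trans ?_ htγ
      refine mul_le_mul_of_nonneg_left ?_ (sq_nonneg t)
      calc (4000000000000 : ℝ) = 2000000 ^ 2 := by norm_num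
        _ ≤ (2000000 * (k : ℝ) ^ 2) ^ 2 := pow_le_pow_left₀ (by norm_num) hγ 2
    calc 2048 * 200000 / 83200 * (1 / ε ^ 2) ≤ 4000000000000 * (t ^ 2 * L) :=
          mul_le_mul (by norm_num) hmt (by positivity) (by norm_num)
      _ = t ^ 2 * 4000000000000 * L := by ring
      _ ≤ 1 * L := by gcongr
      _ = L := one_mul _
  · have e1 : k * w⁻¹ * (8400 * (ε / (200000 * k * ε / (t * w)))) = 8400 / 200000 * t := by
      field_simp
    rw [e1]
    linarith
  · rw [← hw2]
    have e1 : 3 / 16 * (t * w ^ 2 / (83200 * k ^ 2 * ε ^ 2) * t) =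
        3 / (16 * 83200) * (t ^ 2 * w ^ 2 / (k ^ 2 * ε ^ 2)) := by
      field_simp
    have e2 : t ^ 2 * w ^ 2 / (2000000 * (k : ℝ) ^ 2 * ε ^ 2) =
        1 / 2000000 * (t ^ 2 * w ^ 2 / (k ^ 2 * ε ^ 2)) := by
      field_simp
    rw [e1, e2]
    exact mul_le_mul_of_nonneg_right (by norm_num) (by positivity)

end SparseWigner

/-! ### The theorem: transfer of the product-space estimate to the matrix model. -/

theorem mainTheorem5 (k : ℕ) (hk : 1 ≤ k) :
    ∃ γ₀ p₀ : ℝ, 0 < γ₀ ∧ 0 < p₀ ∧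
      ∀ (n : ℕ) (p : unitInterval) (ε t : ℝ),
        2 ≤ n → 4 * Real.log n ≤ n * (p : ℝ) → (p : ℝ) ≤ p₀ →
        0 < ε → ε < 1 / 3 →
        γ₀ / Real.sqrt (Real.log (1 / p)) ≤ t → t ≤ 1 / γ₀ →
        Real.log (t ^ 2 * Real.log (1 / p)) / (t * Real.sqrt (Real.log (1 / p))) ≤ ε →
        ∀ (Ω : Type*) [MeasurableSpace Ω] (P : Measure Ω) [IsProbabilityMeasure P]
          (G Ξ : Ω → SparseWigner.SymMat n),
          SparseWigner.IsBoundedSparseModel P p G Ξ →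
          ∀ f : SparseWigner.SymMat n → ℝ, ConvexOn ℝ Set.univ f →
            (∃ ζ : SparseWigner.SymMat n → SparseWigner.SymMat n,
              Measurable ζ ∧ (∀ K, ζ K ∈ SparseWigner.flat n k ε) ∧
              ∀ K K', f K - f K' ≤ SparseWigner.traceInner (ζ K) (K - K')) →
            Integrable (fun ω => f (SparseWigner.sparse p (G ω) (Ξ ω))) P ∧
            P.real {ω | t < f (SparseWigner.sparse p (G ω) (Ξ ω)) -
                ∫ ω', f (SparseWigner.sparse p (G ω') (Ξ ω')) ∂P} ≤
              2 * Real.exp (-(t ^ 2 * (n * (p : ℝ)) / (γ₀ * ε ^ 2))) := by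
  have hk1 : (1 : ℝ) ≤ k := by exact_mod_cast hk
  refine ⟨2000000 * (k : ℝ) ^ 2, 1 / 2, by positivity, by norm_num, ?_⟩
  intro n p ε t hn hnp hp hε hε3 ht ht1 htε Ω _ P _ G Ξ hM f _ hζ
  obtain ⟨ζ, -, hflat, hsub⟩ := hζ
  obtain ⟨L, η, r, hpL, hreg, hr, hrt, h1, h2, h3, hfin⟩ :=
    SparseWigner.exists_regime hk hn hnp hp hε hε3 ht ht1 htε
  obtain ⟨D, hD⟩ := SparseWigner.exists_flatFamily hflat hsub
  set s := (Real.sqrt (n * (p : ℝ)))⁻¹ with hs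
  have hs0 : 0 ≤ s := by positivity
  set μ : SparseWigner.UpperIndex n → Measure (ℝ × ℝ) := fun e =>
    (P.map fun ω => SparseWigner.upper (G ω) e).prod (P.map fun ω => SparseWigner.upper (Ξ ω) e)
    with hμ
  have : ∀ e, IsProbabilityMeasure (μ e) := fun e => by
    have : IsProbabilityMeasure (P.map fun ω => SparseWigner.upper (G ω) e) :=
      Measure.isProbabilityMeasure_map ((measurable_pi_apply e).comp
        (SparseWigner.measurable_upper.comp hM.measurable_G)).aemeasurable
    have : IsProbabilityMeasure (P.map fun ω => SparseWigner.upper (Ξ ω) e) :=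
      Measure.isProbabilityMeasure_map ((measurable_pi_apply e).comp
        (SparseWigner.measurable_upper.comp hM.measurable_Ξ)).aemeasurable
    rw [hμ]
    infer_instance
  set F : (SparseWigner.UpperIndex n → ℝ × ℝ) → ℝ := fun y =>
    D.truncSup 1 (fun e => s * (SparseWigner.clip (y e) * SparseWigner.isOne (y e))) with hF
  have hFb : SparseWigner.BddMeas F := D.bddMeas_truncSup SparseWigner.measurable_clip
    SparseWigner.abs_clip_le SparseWigner.measurable_isOne SparseWigner.isOne_eq hs0 1
  have hY := hM.measurable_entryPairs
  have hmap := hM.map_entryPairs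
  have hae : ∀ᵐ ω ∂P, f (SparseWigner.sparse p (G ω) (Ξ ω)) =
      F (SparseWigner.entryPairs (G ω) (Ξ ω)) := by
    filter_upwards [hM.ae_sparse_eq] with ω hω
    rw [hω]
    exact (hD _).symm
  have hintegral : ∫ ω, f (SparseWigner.sparse p (G ω) (Ξ ω)) ∂P = ∫ y, F y ∂(Measure.pi μ) := by
    rw [integral_congr_ae hae, hμ, ← hmap,
      integral_map hY.aemeasurable hFb.meas.aestronglyMeasurable]
  refine ⟨((hFb.comp hY).integrable P).congr (hae.mono fun ω h => h.symm), ?_⟩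
  rw [hintegral]
  have hset : P.real {ω | t < f (SparseWigner.sparse p (G ω) (Ξ ω)) - ∫ y, F y ∂(Measure.pi μ)} =
      (Measure.pi μ).real {y | t < F y - ∫ y', F y' ∂(Measure.pi μ)} := by
    have e1 : P.real {ω | t < f (SparseWigner.sparse p (G ω) (Ξ ω)) - ∫ y, F y ∂(Measure.pi μ)} =
        P.real {ω | t < F (SparseWigner.entryPairs (G ω) (Ξ ω)) - ∫ y, F y ∂(Measure.pi μ)} := by
      refine measureReal_congr ?_
      filter_upwards [hae] with ω hω
      change (t < _ - _) = (t < _ - _)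
      rw [hω]
    have hms : MeasurableSet {y | t < F y - ∫ y', F y' ∂(Measure.pi μ)} :=
      measurableSet_lt measurable_const (hFb.meas.sub measurable_const)
    have e2 : (P.map fun ω => SparseWigner.entryPairs (G ω) (Ξ ω)).real
        {y | t < F y - ∫ y', F y' ∂(Measure.pi μ)} =
        P.real {ω | t < F (SparseWigner.entryPairs (G ω) (Ξ ω)) - ∫ y, F y ∂(Measure.pi μ)} :=
      map_measureReal_apply hY hms
    rw [e1, ← e2, hmap]
  rw [hset]
  refine (D.measureReal_truncSup_le μ hreg SparseWigner.measurable_clip SparseWigner.abs_clip_le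
    SparseWigner.measurable_isOne SparseWigner.isOne_eq
    (fun e => (hM.integral_isOne e).trans hpL) hs0 hr hrt h1 h2 h3).trans ?_
  gcongr
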